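/- Let $H\in(0,1)$, and let $J_{1-H}$ denote the Bessel function of the first kind of index $1-H$, $$J_{1-H}(z)=\Bigl(\frac z2\Bigr)^{1-H}\sum_{m=0}^\infty\frac{(-1)^m}{m!\,\Gamma(m+2-H)}\Bigl(\frac z2\Bigr)^{2m}$$ (principal branch of the power). The real zeros of $J_{1-H}$ can be listed, each exactly once, as a strictly increasing two-sided sequence $\cdots<\omega_{-1}<\omega_0=0<\omega_1<\cdots$, and with this (unique) ordering the system of functions $\bigl(t\mapsto e^{2i\omega_k t}\bigr)_{k\in\mathbb Z}$ is a Riesz basis of the complex Hilbert space $L^2[0,1]$, i.e. it is the image of an orthonormal basis of $L^2[0,1]$ under a bounded linear operator of $L^2[0,1]$ onto itself with bounded inverse. -/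

import Mathlib

open MeasureTheory

noncomputable section

/-- The Bessel function of the first kind `J_ν` of real index `ν`,
`J_ν(z) = (z/2)^ν ∑_{m ≥ 0} (-1)^m / (m! Γ(m + ν + 1)) (z/2)^(2m)`,
with the principal branch of the power `(z/2)^ν`. -/
def besselJ (ν : ℝ) (z : ℂ) : ℂ :=
  (z / 2) ^ (ν : ℂ) *
    ∑' m : ℕ, ((-1) ^ m / ((m.factorial : ℂ) * (Real.Gamma (m + ν + 1) : ℂ))) * (z / 2) ^ (2 * m)

/-- `ω` lists the real zeros of `J_ν` as `⋯ < ω (-1) < ω 0 = 0 < ω 1 < ⋯`,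
every real zero exactly once. -/
def IsOrderedBesselZeros (ν : ℝ) (ω : ℤ → ℝ) : Prop :=
  StrictMono ω ∧ ω 0 = 0 ∧ Set.range ω = {x : ℝ | besselJ ν (x : ℂ) = 0}

/-- A Riesz basis of a Hilbert space: the image of an orthonormal basis under a bounded
linear operator with bounded inverse. -/
def IsRieszBasis {ι 𝕜 E : Type*} [RCLike 𝕜] [NormedAddCommGroup E] [InnerProductSpace 𝕜 E]
    (v : ι → E) : Prop :=
  ∃ (b : HilbertBasis ι 𝕜 E) (T : E ≃L[𝕜] E), ∀ i, v i = T (b i)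

/-- The complex Hilbert space `L²[0,1]`. -/
abbrev L2UnitInterval : Type :=
  Lp ℂ 2 ((volume : Measure ℝ).restrict (Set.Icc 0 1))

theorem memLp_exp_unitInterval (a : ℝ) :
    MemLp (fun t : ℝ => Complex.exp (Complex.I * a * t)) 2
      ((volume : Measure ℝ).restrict (Set.Icc 0 1)) := by
  refine MemLp.of_bound (C := 1) (Continuous.aestronglyMeasurable (by fun_prop)) ?_
  refine Filter.Eventually.of_forall fun t => ?_
  have h : Complex.I * a * t = ((a * t : ℝ) : ℂ) * Complex.I := by
    push_cast
    ring
  rw [h, Complex.norm_exp_ofReal_mul_I]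

/-- The exponential `t ↦ exp (i a t)` as an element of `L²[0,1]`. -/
def expL2 (a : ℝ) : L2UnitInterval :=
  (memLp_exp_unitInterval a).toLp _

end

/-! Put `ν = 1 - H`, so `0 < ν < 1`. The `k`-th zero of `J_ν` differs from `kπ` by at most `|ν -
1/2| π/2 < π/4`. Hence `λ_k = ω_k / π` stays within some `L < 1/4` of `k`, and Kadec's 1/4 theorem
makes the functions `e^{2πi λ_k t} = e^{2i ω_k t}` a Riesz basis.

Kadec's theorem is a perturbation argument. After a unimodular normalisation, the difference between
`e^{2πikt}` and `e^{2πi λ_k t}` carries the factor `1 - e^{2πiδ(t - 1/2)}` with `δ = λ_k - k`. Its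
even part is expanded in the frequencies `2πn`, its odd part in `2π(n - 1/2)`. Every coefficient is
bounded by its value at `δ = L`, and these bounds sum to `1 - cos πL + sin πL`, which is below `1`
exactly because `L < 1/4` (`isRieszBasis_expL2_of_abs_sub_le`).

The zeros are located through Poisson's integral for `J_ν`. Moving its contour to the half-line `1 +
iv` gives a positive superposition of `sin (x - (ν - 1/2)θ)` with `0 < θ < π/2`
(`mul_besselSeries_pos`). This fixes the sign away from short bands at the points `kπ`. A sign
change gives a zero in each band with `k > 0`; Rolle's theorem together with the same sign criterion
at index `ν + 1` or `ν - 1` gives uniqueness (`not_two_zeros_besselSeries`). -/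

/-! ### Perturbation of orthonormal bases -/

/-- The assignment `b i ↦ b i - v i` extends by density to an operator `D` with `‖D‖ ≤ q < 1`, so `1
- D` is invertible by the Neumann series, and it carries `b i` to `v i`. -/
theorem isRieszBasis_of_norm_sum_sub_le {ι 𝕜 E : Type*} [RCLike 𝕜] [NormedAddCommGroup E]
    [InnerProductSpace 𝕜 E] [CompleteSpace E] (b : HilbertBasis ι 𝕜 E) (v : ι → E) {q : ℝ}
    (hq0 : 0 ≤ q) (hq : q < 1)
    (h : ∀ c : ι →₀ 𝕜, ‖Finsupp.linearCombination 𝕜 (fun i => b i - v i) c‖ ≤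
      q * ‖Finsupp.linearCombination 𝕜 b c‖) :
    IsRieszBasis (𝕜 := 𝕜) v := by
  classical
  set f := Finsupp.linearCombination 𝕜 (fun i => b i - v i)
  set e := Finsupp.linearCombination 𝕜 (b : ι → E)
  have hd : DenseRange e := by
    have h1 := b.dense_span
    rw [← Finsupp.range_linearCombination, ← Submodule.dense_iff_topologicalClosure_eq_top] at h1
    exact h1
  set D : E →L[𝕜] E := f.extendOfNorm e
  have hD : ‖D‖ < 1 := (LinearMap.opNorm_extendOfNorm_le hd hq0 h).trans_lt hq
  refine ⟨b, ContinuousLinearEquiv.unitsEquiv 𝕜 E (Units.oneSub D hD), fun i => ?_⟩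
  have h2 : D (b i) = b i - v i := by
    have := LinearMap.extendOfNorm_eq (f := f) hd ⟨q, h⟩ (Finsupp.single i 1)
    simpa [e, f, D] using this
  have h3 : (ContinuousLinearEquiv.unitsEquiv 𝕜 E (Units.oneSub D hD)) (b i) = b i - D (b i) := rfl
  rw [h3, h2, sub_sub_cancel]

theorem HilbertBasis.exists_unimodular_smul {ι 𝕜 E : Type*} [RCLike 𝕜] [NormedAddCommGroup E]
    [InnerProductSpace 𝕜 E] [CompleteSpace E] (b : HilbertBasis ι 𝕜 E) (ε : ι → 𝕜)
    (hε : ∀ i, ‖ε i‖ = 1) : ∃ b' : HilbertBasis ι 𝕜 E, ∀ i, b' i = ε i • b i := by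
  classical
  have ho : Orthonormal 𝕜 (fun i => ε i • b i) := by
    refine ⟨fun i => by rw [norm_smul, hε, b.orthonormal.1, mul_one], fun i j hij => ?_⟩
    simp only [inner_smul_left, inner_smul_right, b.orthonormal.2 hij, mul_zero]
  refine ⟨HilbertBasis.mk ho ?_, fun i => by rw [HilbertBasis.coe_mk]⟩
  rw [← b.dense_span]
  refine Submodule.topologicalClosure_mono (Submodule.span_le.2 ?_)
  rintro _ ⟨i, rfl⟩
  have h0 : ε i ≠ 0 := fun h => by simpa [h] using hε i
  have := Submodule.smul_mem (Submodule.span 𝕜 (Set.range fun i => ε i • b i)) (ε i)⁻¹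
    (Submodule.subset_span ⟨i, rfl⟩)
  simpa [smul_smul, inv_mul_cancel₀ h0] using this

/-! ### The Fourier basis of `L²[0,1]` -/

theorem measurePreserving_mk_unitInterval :
    MeasurePreserving ((↑) : ℝ → UnitAddCircle)
      ((volume : Measure ℝ).restrict (Set.Icc 0 1)) AddCircle.haarAddCircle := by
  have h := AddCircle.measurePreserving_mk (1 : ℝ) 0
  rw [AddCircle.volume_eq_smul_haarAddCircle, ENNReal.ofReal_one, one_smul, zero_add,
    restrict_Ioc_eq_restrict_Icc] at h
  exact h

/-- The quotient map to the circle has a measurable section with values in `(0,1]`, and `[0,1]`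
differs from `(0,1]` by a null set. This makes pullback a unitary map, along which the Fourier basis
is transported. -/
theorem compMeasurePreserving_mk_surjective :
    Function.Surjective (Lp.compMeasurePreservingₗᵢ ℂ (E := ℂ) (p := 2) _
      measurePreserving_mk_unitInterval) := by
  intro f
  let g : UnitAddCircle → ℂ := fun x => f (AddCircle.measurableEquivIoc 1 0 x : ℝ)
  have hgm : Measurable g :=
    (Lp.stronglyMeasurable f).measurable.comp
      (measurable_subtype_coe.comp (AddCircle.measurableEquivIoc 1 0).measurable)
  have key : ∀ f₀ : ℝ → ℂ, (fun x : ℝ => f₀ (AddCircle.measurableEquivIoc 1 0 (x : UnitAddCircle)))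
      =ᵐ[(volume : Measure ℝ).restrict (Set.Icc 0 1)] f₀ := by
    intro f₀
    rw [← restrict_Ioc_eq_restrict_Icc]
    refine (ae_restrict_iff' measurableSet_Ioc).2 (Filter.Eventually.of_forall fun x hx => ?_)
    have : AddCircle.equivIoc (1 : ℝ) 0 (x : AddCircle (1 : ℝ)) = ⟨x, by simpa using hx⟩ :=
      AddCircle.equivIoc_coe_eq (by simpa using hx)
    change f₀ (AddCircle.equivIoc (1 : ℝ) 0 (x : AddCircle (1 : ℝ)) : ℝ) = f₀ x
    rw [this]
  have hgf : g ∘ ((↑) : ℝ → UnitAddCircle) =ᵐ[(volume : Measure ℝ).restrict (Set.Icc 0 1)] f :=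
    key f
  have hg : MemLp g 2 AddCircle.haarAddCircle := by
    rw [← measurePreserving_mk_unitInterval.map_eq,
      memLp_map_measure_iff hgm.aestronglyMeasurable
        measurePreserving_mk_unitInterval.measurable.aemeasurable]
    exact (memLp_congr_ae hgf).2 (Lp.memLp f)
  refine ⟨hg.toLp g, ?_⟩
  refine Lp.ext ?_
  refine Filter.EventuallyEq.trans ?_ hgf
  exact (hg.comp_measurePreserving measurePreserving_mk_unitInterval).coeFn_toLp

theorem exists_hilbertBasis_expL2 :
    ∃ b : HilbertBasis ℤ ℂ L2UnitInterval, ∀ k : ℤ, b k = expL2 (2 * Real.pi * k) := by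
  let Φ := LinearIsometryEquiv.ofSurjective _ compMeasurePreserving_mk_surjective
  refine ⟨HilbertBasis.ofRepr (Φ.symm.trans fourierBasis.repr), fun k => ?_⟩
  classical
  rw [← HilbertBasis.repr_symm_single]
  change Φ (fourierBasis.repr.symm (lp.single 2 k 1)) = _
  rw [HilbertBasis.repr_symm_single, coe_fourierBasis]
  refine Lp.ext ?_
  refine Filter.EventuallyEq.trans (g := fun t : ℝ => fourier k (t : UnitAddCircle)) ?_ ?_
  · refine (Lp.coeFn_compMeasurePreserving _ measurePreserving_mk_unitInterval).trans ?_
    exact measurePreserving_mk_unitInterval.quasiMeasurePreserving.ae_eq_comp (coeFn_fourierLp 2 k)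
  · refine Filter.EventuallyEq.trans (Filter.Eventually.of_forall fun t => ?_)
      (MemLp.coeFn_toLp _).symm
    simp only [fourier_coe_apply]
    congr 1
    push_cast
    ring

/-! ### Kadec's two Fourier expansions and the size of their coefficients -/

/-- Since `f 0 = f 1`, the periodisation is continuous, and summable coefficients then give
convergence at every point. The endpoint `t = 0` is needed later to sum the coefficients. -/
theorem hasSum_fourier_of_integral_eq {f : ℝ → ℂ} (hf : Continuous f) (h01 : f 0 = f 1)
    {c : ℤ → ℂ}
    (hc : ∀ n : ℤ, ∫ t in (0 : ℝ)..1, Complex.exp (-(2 * Real.pi * n * Complex.I) * t) * f t = c n)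
    (hs : Summable c) {t : ℝ} (ht : t ∈ Set.Icc (0 : ℝ) 1) :
    HasSum (fun n : ℤ => c n * Complex.exp (2 * Real.pi * n * Complex.I * t)) (f t) := by
  let F : C(UnitAddCircle, ℂ) :=
    ⟨AddCircle.liftIco 1 0 f, AddCircle.liftIco_zero_continuous h01 hf.continuousOn⟩
  have hF : ∀ n, fourierCoeff F n = c n := by
    intro n
    rw [ContinuousMap.coe_mk, fourierCoeff_liftIco_eq, fourierCoeffOn_eq_integral, ← hc n]
    simp only [zero_add, sub_zero, div_one, one_smul, smul_eq_mul]
    refine intervalIntegral.integral_congr fun x _ => ?_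
    simp only [fourier_coe_apply]
    congr 2
    push_cast
    ring
  have hF' : fourierCoeff F = c := funext hF
  have hv : F (t : UnitAddCircle) = f t := by
    rcases eq_or_lt_of_le ht.2 with h | h
    · rw [h, h01.symm, AddCircle.coe_period]
      exact AddCircle.liftIco_zero_coe_apply (p := (1 : ℝ)) (x := 0) (by simp)
    · exact AddCircle.liftIco_zero_coe_apply ⟨ht.1, h⟩
  have := has_pointwise_sum_fourier_series_of_summable (f := F) (by rw [hF']; exact hs) t
  rw [hv] at this
  refine this.congr_fun fun n => ?_
  rw [hF, fourier_coe_apply, smul_eq_mul]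
  congr 2
  push_cast
  ring

/-- Coefficient of `e^{2πint}` in the expansion of `1 - cos (2πδ(t - 1/2))` on `[0,1]`. -/
noncomputable def kadecCos (δ : ℝ) (n : ℤ) : ℝ :=
  if n = 0 then 1 - Real.sinc (Real.pi * δ)
  else δ * Real.sin (Real.pi * δ) / (Real.pi * ((n : ℝ) ^ 2 - δ ^ 2))

/-- Up to the factor `-i`, the coefficient of `e^{2πi(n-1/2)t}` in the expansion of
`i sin (2πδ(t - 1/2))` on `[0,1]`. -/
noncomputable def kadecSin (δ : ℝ) (n : ℤ) : ℝ :=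
  δ * Real.cos (Real.pi * δ) / (Real.pi * (((n : ℝ) - 1 / 2) ^ 2 - δ ^ 2))

theorem one_le_sq_of_int_ne_zero {n : ℤ} (hn : n ≠ 0) : (1 : ℝ) ≤ (n : ℝ) ^ 2 := by
  have : (1 : ℤ) ≤ n ^ 2 := by
    have : 0 < n ^ 2 := by positivity
    omega
  exact_mod_cast this

theorem sq_le_four_mul_sub_half_sq {n : ℤ} : (n : ℝ) ^ 2 ≤ 4 * ((n : ℝ) - 1 / 2) ^ 2 := by
  have h : (0 : ℤ) ≤ (n - 1) * (3 * n - 1) := by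
    rcases le_or_gt n 0 with h | h
    · nlinarith
    · exact mul_nonneg (by omega) (by omega)
  have h' : (0 : ℝ) ≤ ((n : ℝ) - 1) * (3 * n - 1) := by exact_mod_cast h
  nlinarith

theorem one_le_four_mul_sub_half_sq (n : ℤ) : (1 : ℝ) ≤ 4 * ((n : ℝ) - 1 / 2) ^ 2 := by
  have h : (0 : ℤ) ≤ n * (n - 1) := by
    rcases le_or_gt n 0 with h | h
    · nlinarith
    · exact mul_nonneg (by omega) (by omega)
  have h' : (0 : ℝ) ≤ (n : ℝ) * (n - 1) := by exact_mod_cast h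
  nlinarith

theorem summable_const_div_of_sq_le {C : ℝ} {g : ℤ → ℝ}
    (hg : ∀ n : ℤ, n ≠ 0 → (n : ℝ) ^ 2 ≤ 8 * g n) : Summable fun n : ℤ => C / g n := by
  refine Summable.of_norm_bounded_eventually
    (((Real.summable_one_div_int_pow (p := 2)).2 one_lt_two).mul_left (8 * |C|)) ?_
  refine (Set.finite_singleton (0 : ℤ)).subset fun n hn => ?_
  by_contra hn0
  refine hn ?_
  have h1 := one_le_sq_of_int_ne_zero hn0
  have h2 := hg n hn0
  have h3 : 0 < g n := by linarith
  change ‖C / g n‖ ≤ 8 * |C| * (1 / (n : ℝ) ^ 2)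
  rw [Real.norm_eq_abs, abs_div, abs_of_pos h3, mul_one_div, div_le_div_iff₀ h3 (by linarith)]
  nlinarith [abs_nonneg C]

theorem summable_kadecCos {δ : ℝ} (hδ : |δ| ≤ 1 / 4) : Summable (kadecCos δ) := by
  have hd : δ ^ 2 ≤ 1 / 16 := by
    rw [← sq_abs]; nlinarith [abs_nonneg δ]
  have h : Summable fun n : ℤ =>
      δ * Real.sin (Real.pi * δ) / (Real.pi * ((n : ℝ) ^ 2 - δ ^ 2)) := by
    refine summable_const_div_of_sq_le fun n hn => ?_
    have h1 := one_le_sq_of_int_ne_zero hn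
    nlinarith [Real.pi_gt_three]
  refine h.congr_cofinite ?_
  refine (Set.finite_singleton (0 : ℤ)).subset fun n hn => ?_
  by_contra hn0
  exact hn (by simp [kadecCos, show n ≠ 0 from hn0])

theorem summable_kadecSin {δ : ℝ} (hδ : |δ| ≤ 1 / 4) : Summable (kadecSin δ) := by
  have hd : δ ^ 2 ≤ 1 / 16 := by
    rw [← sq_abs]; nlinarith [abs_nonneg δ]
  refine summable_const_div_of_sq_le fun n hn => ?_
  have h1 := one_le_sq_of_int_ne_zero hn
  have h2 := sq_le_four_mul_sub_half_sq (n := n)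
  nlinarith [Real.pi_gt_three]

theorem exp_two_pi_mul_int_mul_I (n : ℤ) : Complex.exp (2 * Real.pi * n * Complex.I) = 1 := by
  rw [← Complex.exp_int_mul_two_pi_mul_I n]
  congr 1
  ring

theorem int_sq_sub_sq_ne_zero {δ : ℝ} (hδ : |δ| ≤ 1 / 4) (h0 : δ ≠ 0) (n : ℤ) :
    (n : ℝ) ^ 2 - δ ^ 2 ≠ 0 := by
  have hd : δ ^ 2 ≤ 1 / 16 := by
    rw [← sq_abs]; nlinarith [abs_nonneg δ]
  by_cases hn : n = 0
  · simp [hn, h0]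
  · have h1 := one_le_sq_of_int_ne_zero hn
    linarith

theorem half_sq_sub_ne_zero {δ : ℝ} (hδ : |δ| ≤ 1 / 4) (n : ℤ) :
    ((n : ℝ) - 1 / 2) ^ 2 - δ ^ 2 ≠ 0 := by
  have hd : δ ^ 2 ≤ 1 / 16 := by
    rw [← sq_abs]; nlinarith [abs_nonneg δ]
  have h1 := one_le_four_mul_sub_half_sq n
  linarith

theorem hasSum_kadecCos {δ : ℝ} (hδ : |δ| ≤ 1 / 4) {t : ℝ} (ht : t ∈ Set.Icc (0 : ℝ) 1) :
    HasSum (fun n : ℤ => (kadecCos δ n : ℂ) * Complex.exp (2 * Real.pi * n * Complex.I * t))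
      (1 - Complex.cos (2 * Real.pi * δ * (t - 1 / 2))) := by
  -- For `δ = 0` the denominator `n² - δ²` vanishes at `n = 0`, so the computation below does not
  -- apply.
  by_cases h0 : δ = 0
  · subst h0
    have : kadecCos 0 = 0 := by
      funext n
      simp [kadecCos]
    simp [this, hasSum_zero]
  have hc : ∀ n : ℤ, ∫ t in (0 : ℝ)..1, Complex.exp (-(2 * Real.pi * n * Complex.I) * t) *
      Complex.cos (2 * Real.pi * δ * (t - 1 / 2)) = (if n = 0 then 1 else 0) - kadecCos δ n := by
    intro n
    have hne := int_sq_sub_sq_ne_zero hδ h0 n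
    have hne' : (n : ℂ) ^ 2 - (δ : ℂ) ^ 2 ≠ 0 := by exact_mod_cast hne
    have hm : (n : ℂ) - δ ≠ 0 := fun h => hne' (by rw [sq_sub_sq, h, mul_zero])
    have hp : (n : ℂ) + δ ≠ 0 := fun h => hne' (by rw [sq_sub_sq, h, zero_mul])
    have hpi : (Real.pi : ℂ) ≠ 0 := by exact_mod_cast Real.pi_ne_zero
    have hI := Complex.I_ne_zero
    have hR : ((if n = 0 then 1 else 0) - kadecCos δ n : ℂ) =
        -(δ * Complex.sin (Real.pi * δ) / (Real.pi * ((n : ℂ) ^ 2 - δ ^ 2))) := by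
      by_cases hn : n = 0
      · have h0' : (δ : ℂ) ≠ 0 := by exact_mod_cast h0
        simp only [kadecCos, hn, if_true,
          Real.sinc_of_ne_zero (mul_ne_zero Real.pi_ne_zero h0)]
        push_cast
        field_simp
        ring
      · simp [kadecCos, hn]
    rw [hR]
    have h1 : ∀ t : ℝ, Complex.exp (-(2 * Real.pi * n * Complex.I) * t) *
        Complex.cos (2 * Real.pi * δ * (t - 1 / 2)) =
        Complex.exp (-(Real.pi * δ * Complex.I)) / 2 *
          Complex.exp ((-(2 * Real.pi * Complex.I) * (n - δ)) * t) +
        Complex.exp (Real.pi * δ * Complex.I) / 2 *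
          Complex.exp ((-(2 * Real.pi * Complex.I) * (n + δ)) * t) := by
      intro t
      rw [Complex.cos, div_mul_eq_mul_div, div_mul_eq_mul_div, ← Complex.exp_add, ← Complex.exp_add,
        ← add_div, mul_div_assoc', mul_add, ← Complex.exp_add, ← Complex.exp_add]
      congr 3 <;> ring
    simp_rw [h1]
    rw [intervalIntegral.integral_add (Continuous.intervalIntegrable (by fun_prop) _ _)
      (Continuous.intervalIntegrable (by fun_prop) _ _), intervalIntegral.integral_const_mul,
      intervalIntegral.integral_const_mul, integral_exp_mul_complex (by simp [hm, hpi]),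
      integral_exp_mul_complex (by simp [hp, hpi])]
    have e1 : Complex.exp (-(2 * Real.pi * Complex.I) * (n - δ) * (1 : ℝ)) =
        Complex.exp (Real.pi * δ * Complex.I) * Complex.exp (Real.pi * δ * Complex.I) := by
      rw [← Complex.exp_add, ← one_mul (Complex.exp (_ + _)),
        ← exp_two_pi_mul_int_mul_I (-n), ← Complex.exp_add]
      congr 1
      push_cast
      ring
    have e2 : Complex.exp (-(2 * Real.pi * Complex.I) * (n + δ) * (1 : ℝ)) =
        Complex.exp (-(Real.pi * δ * Complex.I)) * Complex.exp (-(Real.pi * δ * Complex.I)) := by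
      rw [← Complex.exp_add, ← one_mul (Complex.exp (_ + _)),
        ← exp_two_pi_mul_int_mul_I (-n), ← Complex.exp_add]
      congr 1
      push_cast
      ring
    rw [e1, e2, Complex.sin, neg_mul (Real.pi * δ : ℂ)]
    simp only [Complex.ofReal_zero, mul_zero, Complex.exp_zero]
    have e3 : Complex.exp (Real.pi * δ * Complex.I) * Complex.exp (-(Real.pi * δ * Complex.I)) = 1 := by
      rw [← Complex.exp_add, add_neg_cancel, Complex.exp_zero]
    generalize Complex.exp (Real.pi * δ * Complex.I) = u at *
    generalize Complex.exp (-(Real.pi * δ * Complex.I)) = w at *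
    have f1 : w / 2 * ((u * u - 1) / (-(2 * Real.pi * Complex.I) * (n - δ))) =
        (u - w) / (-(4 * Real.pi * Complex.I) * (n - δ)) := by
      field_simp
      linear_combination (-4 * u) * e3
    have f2 : u / 2 * ((w * w - 1) / (-(2 * Real.pi * Complex.I) * (n + δ))) =
        (w - u) / (-(4 * Real.pi * Complex.I) * (n + δ)) := by
      field_simp
      linear_combination (-4 * w) * e3
    rw [f1, f2]
    field_simp
    rw [Complex.I_sq]
    ring
  have hs : Summable fun n : ℤ => ((if n = 0 then 1 else 0) - kadecCos δ n : ℂ) :=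
    ((hasSum_ite_eq (0 : ℤ) (1 : ℂ)).summable).sub (Complex.summable_ofReal.2 (summable_kadecCos hδ))
  have h2 := hasSum_fourier_of_integral_eq
    (f := fun t : ℝ => Complex.cos (2 * Real.pi * δ * (t - 1 / 2))) (by fun_prop)
    (by
      rw [← Complex.cos_neg]
      congr 1
      push_cast
      ring) hc hs ht
  refine ((hasSum_ite_eq (0 : ℤ) (1 : ℂ)).sub h2).congr_fun fun n => ?_
  by_cases hn : n = 0
  · simp [hn]
  · simp [hn]

/-- The sine is odd about `t = 1/2`, so it takes opposite values at `0` and `1`. Multiplying by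
`e^{πit}` makes the endpoint values agree, and dividing it out again produces the half-integer
frequencies. -/
theorem hasSum_kadecSin {δ : ℝ} (hδ : |δ| ≤ 1 / 4) {t : ℝ} (ht : t ∈ Set.Icc (0 : ℝ) 1) :
    HasSum (fun n : ℤ => (Complex.I * kadecSin δ n : ℂ) *
      Complex.exp ((2 * Real.pi * n - Real.pi) * Complex.I * t))
      (-(Complex.I * Complex.sin (2 * Real.pi * δ * (t - 1 / 2)))) := by
  have hc : ∀ n : ℤ, ∫ t in (0 : ℝ)..1, Complex.exp (-(2 * Real.pi * n * Complex.I) * t) *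
      (Complex.exp (Real.pi * Complex.I * t) *
        -(Complex.I * Complex.sin (2 * Real.pi * δ * (t - 1 / 2)))) =
        Complex.I * kadecSin δ n := by
    intro n
    have hne := half_sq_sub_ne_zero hδ n
    have hne' : ((n : ℂ) - 1 / 2) ^ 2 - (δ : ℂ) ^ 2 ≠ 0 := by
      have := Complex.ofReal_ne_zero.2 hne
      push_cast at this
      exact this
    have hm : (n : ℂ) - 1 / 2 - δ ≠ 0 := fun h => hne' (by rw [sq_sub_sq, h, mul_zero])
    have hp : (n : ℂ) - 1 / 2 + δ ≠ 0 := fun h => hne' (by rw [sq_sub_sq, h, zero_mul])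
    have hpi : (Real.pi : ℂ) ≠ 0 := by exact_mod_cast Real.pi_ne_zero
    have hI := Complex.I_ne_zero
    have h1 : ∀ t : ℝ, Complex.exp (-(2 * Real.pi * n * Complex.I) * t) *
      (Complex.exp (Real.pi * Complex.I * t) *
        -(Complex.I * Complex.sin (2 * Real.pi * δ * (t - 1 / 2)))) =
        Complex.exp (Real.pi * δ * Complex.I) / 2 *
          Complex.exp ((-(2 * Real.pi * Complex.I) * (n - 1 / 2 + δ)) * t) -
        Complex.exp (-(Real.pi * δ * Complex.I)) / 2 *
          Complex.exp ((-(2 * Real.pi * Complex.I) * (n - 1 / 2 - δ)) * t) := by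
      intro t
      have : -(Complex.I * Complex.sin (2 * Real.pi * δ * (t - 1 / 2))) =
        (Complex.exp (-(2 * Real.pi * δ * (t - 1 / 2)) * Complex.I) -
          Complex.exp ((2 * Real.pi * δ * (t - 1 / 2)) * Complex.I)) / 2 := by
        rw [Complex.sin]
        linear_combination (-1 / 2) * (Complex.exp (-(2 * Real.pi * δ * (t - 1 / 2)) * Complex.I) -
          Complex.exp ((2 * Real.pi * δ * (t - 1 / 2)) * Complex.I)) * Complex.I_sq
      rw [this, div_mul_eq_mul_div, div_mul_eq_mul_div, ← Complex.exp_add, ← Complex.exp_add,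
        ← sub_div, mul_div_assoc', mul_div_assoc', mul_sub, mul_sub, ← Complex.exp_add,
        ← Complex.exp_add, ← Complex.exp_add, ← Complex.exp_add]
      congr 3 <;> ring
    simp_rw [h1]
    rw [intervalIntegral.integral_sub (Continuous.intervalIntegrable (by fun_prop) _ _)
      (Continuous.intervalIntegrable (by fun_prop) _ _), intervalIntegral.integral_const_mul,
      intervalIntegral.integral_const_mul,
      integral_exp_mul_complex (mul_ne_zero (by simp [hpi]) hm),
      integral_exp_mul_complex (mul_ne_zero (by simp [hpi]) hp)]
    have e1 : Complex.exp (-(2 * Real.pi * Complex.I) * (n - 1 / 2 - δ) * (1 : ℝ)) =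
        -(Complex.exp (Real.pi * δ * Complex.I) * Complex.exp (Real.pi * δ * Complex.I)) := by
      have e0 : Complex.exp (-(2 * Real.pi * Complex.I) * (n - 1 / 2 - δ) * (1 : ℝ)) =
          Complex.exp (2 * Real.pi * (-n : ℤ) * Complex.I) * Complex.exp (Real.pi * Complex.I) *
          Complex.exp (Real.pi * δ * Complex.I) * Complex.exp (Real.pi * δ * Complex.I) := by
        rw [← Complex.exp_add, ← Complex.exp_add, ← Complex.exp_add]
        congr 1
        push_cast
        ring
      rw [e0, exp_two_pi_mul_int_mul_I, Complex.exp_pi_mul_I]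
      ring
    have e2 : Complex.exp (-(2 * Real.pi * Complex.I) * (n - 1 / 2 + δ) * (1 : ℝ)) =
        -(Complex.exp (-(Real.pi * δ * Complex.I)) * Complex.exp (-(Real.pi * δ * Complex.I))) := by
      have e0 : Complex.exp (-(2 * Real.pi * Complex.I) * (n - 1 / 2 + δ) * (1 : ℝ)) =
          Complex.exp (2 * Real.pi * (-n : ℤ) * Complex.I) * Complex.exp (Real.pi * Complex.I) *
          Complex.exp (-(Real.pi * δ * Complex.I)) * Complex.exp (-(Real.pi * δ * Complex.I)) := by
        rw [← Complex.exp_add, ← Complex.exp_add, ← Complex.exp_add]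
        congr 1
        push_cast
        ring
      rw [e0, exp_two_pi_mul_int_mul_I, Complex.exp_pi_mul_I]
      ring
    rw [e1, e2, kadecSin]
    push_cast
    rw [Complex.cos, neg_mul (Real.pi * δ : ℂ)]
    simp only [mul_zero, Complex.exp_zero]
    have e3 : Complex.exp (Real.pi * δ * Complex.I) * Complex.exp (-(Real.pi * δ * Complex.I)) = 1 := by
      rw [← Complex.exp_add, add_neg_cancel, Complex.exp_zero]
    generalize Complex.exp (Real.pi * δ * Complex.I) = u at *
    generalize Complex.exp (-(Real.pi * δ * Complex.I)) = w at *
    have f1 : w / 2 * ((-(u * u) - 1) / (-(2 * Real.pi * Complex.I) * (n - 1 / 2 - δ))) =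
        (u + w) / ((4 * Real.pi * Complex.I) * (n - 1 / 2 - δ)) := by
      rw [div_mul_div_comm, div_eq_div_iff (mul_ne_zero two_ne_zero (mul_ne_zero (by simp [hpi]) hm))
        (mul_ne_zero (by simp [hpi]) hm)]
      linear_combination (-u) * (4 * Real.pi * Complex.I) * (n - 1 / 2 - δ) * e3
    have f2 : u / 2 * ((-(w * w) - 1) / (-(2 * Real.pi * Complex.I) * (n - 1 / 2 + δ))) =
        (u + w) / ((4 * Real.pi * Complex.I) * (n - 1 / 2 + δ)) := by
      rw [div_mul_div_comm, div_eq_div_iff (mul_ne_zero two_ne_zero (mul_ne_zero (by simp [hpi]) hp))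
        (mul_ne_zero (by simp [hpi]) hp)]
      linear_combination (-w) * (4 * Real.pi * Complex.I) * (n - 1 / 2 + δ) * e3
    rw [f1, f2, sq_sub_sq]
    generalize (n : ℂ) - 1 / 2 = m at *
    field_simp
    rw [Complex.I_sq]
    ring
  have hs : Summable fun n : ℤ => (Complex.I * kadecSin δ n : ℂ) :=
    (Complex.summable_ofReal.2 (summable_kadecSin hδ)).mul_left _
  have h2 := hasSum_fourier_of_integral_eq
    (f := fun t : ℝ => Complex.exp (Real.pi * Complex.I * t) *
        -(Complex.I * Complex.sin (2 * Real.pi * δ * (t - 1 / 2)))) (by fun_prop)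
    (by
      simp only [Complex.ofReal_one, mul_one, Complex.exp_pi_mul_I, Complex.ofReal_zero, mul_zero,
        Complex.exp_zero]
      rw [one_mul, neg_one_mul, neg_neg, ← mul_neg, ← Complex.sin_neg, ← mul_neg]
      congr 3
      ring) hc hs ht
  have h3 := h2.mul_left (Complex.exp (-(Real.pi * Complex.I * t)))
  rw [← mul_assoc, ← Complex.exp_add, neg_add_cancel, Complex.exp_zero, one_mul] at h3
  refine h3.congr_fun fun n => ?_
  rw [mul_left_comm, ← Complex.exp_add]
  congr 2
  ring

/-- At `t = 0` all exponentials equal `1`. For `0 ≤ δ ≤ 1/4` the coefficients are nonnegative, so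
this value is also the sum of their absolute values. -/
theorem hasSum_kadecCos_eq {δ : ℝ} (hδ : |δ| ≤ 1 / 4) :
    HasSum (kadecCos δ) (1 - Real.cos (Real.pi * δ)) := by
  have h := hasSum_kadecCos hδ (t := 0) (by simp)
  rw [← Complex.hasSum_ofReal]
  convert h using 1
  · funext n
    simp
  · push_cast
    rw [← Complex.cos_neg]
    congr 2
    ring

theorem hasSum_kadecSin_eq {δ : ℝ} (hδ : |δ| ≤ 1 / 4) :
    HasSum (kadecSin δ) (Real.sin (Real.pi * δ)) := by
  have h := (hasSum_kadecSin hδ (t := 0) (by simp)).mul_left (-Complex.I)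
  rw [← Complex.hasSum_ofReal]
  have e : (Real.sin (Real.pi * δ) : ℂ) =
      -Complex.I * -(Complex.I * Complex.sin (2 * Real.pi * δ * ((0 : ℝ) - 1 / 2))) := by
    push_cast
    rw [← mul_neg, ← mul_assoc, neg_mul, Complex.I_mul_I, neg_neg, one_mul, ← Complex.sin_neg]
    congr 1
    ring
  rw [e]
  refine h.congr_fun fun n => ?_
  simp only [Complex.ofReal_zero, mul_zero, Complex.exp_zero, mul_one]
  rw [← mul_assoc, neg_mul, Complex.I_mul_I, neg_neg, one_mul]

theorem kadecCos_abs (δ : ℝ) (n : ℤ) : kadecCos |δ| n = kadecCos δ n := by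
  rcases abs_choice δ with h | h
  · rw [h]
  · rw [h, kadecCos, kadecCos, mul_neg, Real.sinc_neg, Real.sin_neg, neg_mul_neg, neg_sq]

theorem abs_kadecSin (δ : ℝ) (n : ℤ) : |kadecSin |δ| n| = |kadecSin δ n| := by
  rcases abs_choice δ with h | h
  · rw [h]
  · rw [h, kadecSin, kadecSin, mul_neg, Real.cos_neg, neg_mul, neg_div, abs_neg, neg_sq]

/-- `sinc` is the slope of the chord of `sin` from `0`, which decreases by concavity. This controls
the coefficient `n = 0` in `kadecCos_mono`. -/
theorem sinc_antitoneOn : AntitoneOn Real.sinc (Set.Icc 0 Real.pi) := by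
  intro x hx y hy hxy
  rcases eq_or_lt_of_le hx.1 with h0 | h0
  · rw [← h0, Real.sinc_zero]
    exact Real.sinc_le_one y
  · have h := strictConcaveOn_sin_Icc.concaveOn.antitoneOn_slope_gt
      (x := 0) ⟨le_rfl, Real.pi_pos.le⟩ ⟨hx, h0⟩ ⟨hy, h0.trans_le hxy⟩ hxy
    rw [Real.sinc_of_ne_zero h0.ne', Real.sinc_of_ne_zero (h0.trans_le hxy).ne']
    simpa [slope_def_field] using h

/-- The derivative is `cos x - x sin x`; on this interval `x ≤ π/4 < 1` and `0 ≤ sin x ≤ cos x`. It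
controls the numerators in `kadecSin_mono`. -/
theorem mul_cos_monotoneOn : MonotoneOn (fun x : ℝ => x * Real.cos x) (Set.Icc 0 (Real.pi / 4)) := by
  refine monotoneOn_of_deriv_nonneg (convex_Icc _ _) (by fun_prop) (by fun_prop) fun x hx => ?_
  rw [interior_Icc] at hx
  have h1 : deriv (fun x : ℝ => x * Real.cos x) x = Real.cos x - x * Real.sin x := by
    have := ((hasDerivAt_id x).mul (Real.hasDerivAt_cos x)).deriv
    simp only [id, one_mul] at this
    rw [show (fun x : ℝ => x * Real.cos x) = (id * Real.cos) from rfl, this]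
    ring
  rw [h1]
  have hpi := Real.pi_lt_four
  have hpi' := Real.pi_pos
  have h2 : Real.sin x ≤ Real.cos x := by
    rw [← Real.cos_pi_div_two_sub]
    exact Real.cos_le_cos_of_nonneg_of_le_pi hx.1.le (by linarith [hx.1, hx.2]) (by linarith [hx.2])
  have h3 : 0 ≤ Real.sin x := Real.sin_nonneg_of_nonneg_of_le_pi hx.1.le (by linarith [hx.2])
  nlinarith [hx.1, hx.2]

theorem kadecCos_mono {x y : ℝ} (hx : 0 ≤ x) (hxy : x ≤ y) (hy : y ≤ 1 / 4) (n : ℤ) :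
    kadecCos x n ≤ kadecCos y n := by
  have hpi := Real.pi_pos
  have h1 : Real.pi * x ≤ Real.pi * y := by gcongr
  have hpx : 0 ≤ Real.pi * x := by positivity
  have h2 : Real.pi * y ≤ Real.pi / 4 := by nlinarith
  have hy0 : 0 ≤ y := hx.trans hxy
  unfold kadecCos
  split_ifs with hn
  · have := sinc_antitoneOn ⟨hpx, by linarith⟩ ⟨hpx.trans h1, by linarith⟩ h1
    linarith
  · have h3 := one_le_sq_of_int_ne_zero hn
    have h4 : Real.sin (Real.pi * x) ≤ Real.sin (Real.pi * y) :=
      Real.sin_le_sin_of_le_of_le_pi_div_two (by linarith) (by linarith) h1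
    have h5 : 0 ≤ Real.sin (Real.pi * x) := Real.sin_nonneg_of_nonneg_of_le_pi hpx (by linarith)
    have h6 : 0 < (n : ℝ) ^ 2 - y ^ 2 := by nlinarith
    have h7 : (n : ℝ) ^ 2 - y ^ 2 ≤ (n : ℝ) ^ 2 - x ^ 2 := by nlinarith
    exact div_le_div₀ (mul_nonneg hy0 (h5.trans h4)) (mul_le_mul hxy h4 h5 (by linarith)) (by positivity)
      (mul_le_mul_of_nonneg_left h7 hpi.le)

theorem kadecCos_nonneg {x : ℝ} (hx : 0 ≤ x) (hx' : x ≤ 1 / 4) (n : ℤ) : 0 ≤ kadecCos x n := by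
  refine le_trans (le_of_eq ?_) (kadecCos_mono le_rfl hx hx' n)
  simp [kadecCos]

theorem kadecSin_mono {x y : ℝ} (hx : 0 ≤ x) (hxy : x ≤ y) (hy : y ≤ 1 / 4) (n : ℤ) :
    kadecSin x n ≤ kadecSin y n := by
  have hpi := Real.pi_pos
  have h1 : Real.pi * x ≤ Real.pi * y := by gcongr
  have hpx : 0 ≤ Real.pi * x := by positivity
  have h2 : Real.pi * y ≤ Real.pi / 4 := by nlinarith
  have h3 := one_le_four_mul_sub_half_sq n
  have h4 := mul_cos_monotoneOn ⟨hpx, by linarith⟩ ⟨hpx.trans h1, h2⟩ h1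
  simp only [mul_assoc] at h4
  have h5 : 0 ≤ Real.cos (Real.pi * y) :=
    Real.cos_nonneg_of_neg_pi_div_two_le_of_le (by linarith) (by linarith)
  have h6 : 0 < ((n : ℝ) - 1 / 2) ^ 2 - y ^ 2 := by nlinarith
  have h7 : ((n : ℝ) - 1 / 2) ^ 2 - y ^ 2 ≤ ((n : ℝ) - 1 / 2) ^ 2 - x ^ 2 := by nlinarith
  have hy0 : 0 ≤ y := hx.trans hxy
  exact div_le_div₀ (by positivity) (le_of_mul_le_mul_left h4 hpi) (by positivity)
    (mul_le_mul_of_nonneg_left h7 hpi.le)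

theorem kadecSin_nonneg {x : ℝ} (hx : 0 ≤ x) (hx' : x ≤ 1 / 4) (n : ℤ) : 0 ≤ kadecSin x n := by
  refine le_trans (le_of_eq ?_) (kadecSin_mono le_rfl hx hx' n)
  simp [kadecSin]

/-! ### Exponential series in `L²[0,1]` and Kadec's theorem -/

theorem norm_exp_I_mul_mul (a t : ℝ) : ‖Complex.exp (Complex.I * a * t)‖ = 1 := by
  have h : Complex.I * a * t = ((a * t : ℝ) : ℂ) * Complex.I := by
    push_cast
    ring
  rw [h, Complex.norm_exp_ofReal_mul_I]

/-- The exponential `t ↦ exp (i a t)` as a bounded continuous function. -/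
noncomputable def expBCF (a : ℝ) : BoundedContinuousFunction ℝ ℂ :=
  BoundedContinuousFunction.ofNormedAddCommGroup (fun t : ℝ => Complex.exp (Complex.I * a * t))
    (by fun_prop) 1 fun t => (norm_exp_I_mul_mul a t).le

theorem expBCF_apply (a t : ℝ) : expBCF a t = Complex.exp (Complex.I * a * t) := rfl

theorem toLp_expBCF (a : ℝ) :
    BoundedContinuousFunction.toLp 2 ((volume : Measure ℝ).restrict (Set.Icc 0 1)) ℂ (expBCF a) =
      expL2 a :=
  Lp.ext ((BoundedContinuousFunction.coeFn_toLp _ _ _ _).trans (MemLp.coeFn_toLp _).symm)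

/-- Absolute summability gives convergence in the sup norm, hence in `L²`. The limit need only agree
with `G` on `[0,1]`: half-integer frequencies and general `δ` give no common period. -/
theorem hasSum_smul_expL2 {J : Type*} {r : J → ℂ} {x : J → ℝ} (hr : Summable fun j => ‖r j‖)
    (G : BoundedContinuousFunction ℝ ℂ)
    (h : ∀ t ∈ Set.Icc (0 : ℝ) 1, HasSum (fun j => r j * expBCF (x j) t) (G t)) :
    HasSum (fun j => r j • expL2 (x j))
      (BoundedContinuousFunction.toLp 2 ((volume : Measure ℝ).restrict (Set.Icc 0 1)) ℂ G) := by
  have hs : Summable fun j => r j • expBCF (x j) := by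
    refine Summable.of_norm_bounded hr fun j => ?_
    rw [norm_smul]
    refine mul_le_of_le_one_right (norm_nonneg _) ?_
    exact BoundedContinuousFunction.norm_ofNormedAddCommGroup_le _ zero_le_one _
  obtain ⟨G', hG'⟩ := hs
  have h1 := (BoundedContinuousFunction.toLp 2
    ((volume : Measure ℝ).restrict (Set.Icc 0 1)) ℂ).hasSum hG'
  simp only [map_smul, toLp_expBCF] at h1
  convert h1 using 1
  refine Lp.ext ((BoundedContinuousFunction.coeFn_toLp _ _ _ _).trans
    (Filter.EventuallyEq.trans ?_ (BoundedContinuousFunction.coeFn_toLp _ _ _ _).symm))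
  refine (ae_restrict_iff' measurableSet_Icc).2 (Filter.Eventually.of_forall fun t ht => ?_)
  refine (h t ht).unique ?_
  have h2 := (BoundedContinuousFunction.evalCLM ℂ t).hasSum hG'
  refine h2.congr_fun fun j => ?_
  rfl

theorem inner_expL2 (a b : ℝ) :
    inner ℂ (expL2 a) (expL2 b) =
      ∫ t in Set.Icc (0 : ℝ) 1, Complex.exp (Complex.I * (b - a : ℝ) * t) := by
  rw [L2.inner_def]
  refine integral_congr_ae ?_
  filter_upwards [(memLp_exp_unitInterval a).coeFn_toLp,
    (memLp_exp_unitInterval b).coeFn_toLp] with t ha hb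
  rw [expL2, expL2, ha, hb, RCLike.inner_apply, ← Complex.exp_conj, ← Complex.exp_add]
  congr 1
  simp only [map_mul, Complex.conj_I, Complex.conj_ofReal]
  push_cast
  ring

/-- Inner products of exponentials depend only on differences of frequencies, so a common shift `a`
is harmless. -/
theorem orthonormal_expL2 (a : ℝ) :
    Orthonormal ℂ fun k : ℤ => expL2 (2 * Real.pi * k + a) := by
  obtain ⟨b, hb⟩ := exists_hilbertBasis_expL2
  have h := b.orthonormal
  classical
  rw [orthonormal_iff_ite] at h ⊢
  intro i j
  rw [← h i j, hb, hb, inner_expL2, inner_expL2]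
  congr 4
  ring_nf

theorem Orthonormal.norm_sq_linearCombination {ι 𝕜 E : Type*} [RCLike 𝕜] [NormedAddCommGroup E]
    [InnerProductSpace 𝕜 E] {v : ι → E} (hv : Orthonormal 𝕜 v) (c : ι →₀ 𝕜) :
    ‖Finsupp.linearCombination 𝕜 v c‖ ^ 2 = ∑ i ∈ c.support, ‖c i‖ ^ 2 := by
  rw [← RCLike.ofReal_inj (K := 𝕜)]
  push_cast
  rw [← inner_self_eq_norm_sq_to_K (𝕜 := 𝕜), hv.inner_finsupp_eq_sum_left, Finsupp.sum]
  exact Finset.sum_congr rfl fun i _ => RCLike.conj_mul _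

/-- Interchange the sums over `i` and `j`. For fixed `j`, orthonormality of `g j` bounds the `j`-th
term by `α j` times the `ℓ²` norm of `c`; the triangle inequality over `j` then gives the factor
`q`. -/
theorem norm_linearCombination_sub_le {ι J 𝕜 E : Type*} [RCLike 𝕜] [NormedAddCommGroup E]
    [InnerProductSpace 𝕜 E] {b v : ι → E} (hb : Orthonormal 𝕜 b) {g : J → ι → E}
    (hg : ∀ j, Orthonormal 𝕜 (g j)) {a : J → ι → 𝕜} {α : J → ℝ} {q : ℝ}
    (hα : ∀ j, 0 ≤ α j) (ha : ∀ j i, ‖a j i‖ ≤ α j) (hq : HasSum α q)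
    (h : ∀ i, HasSum (fun j => a j i • g j i) (b i - v i)) (c : ι →₀ 𝕜) :
    ‖Finsupp.linearCombination 𝕜 (fun i => b i - v i) c‖ ≤
      q * ‖Finsupp.linearCombination 𝕜 b c‖ := by
  have h1 : HasSum (fun j => ∑ i ∈ c.support, (c i * a j i) • g j i)
      (Finsupp.linearCombination 𝕜 (fun i => b i - v i) c) := by
    rw [Finsupp.linearCombination_apply, Finsupp.sum]
    refine hasSum_sum fun i _ => ?_
    simp only [mul_smul]
    exact (h i).const_smul (c i)
  refine h1.norm_le_of_bounded (hq.mul_right _) fun j => ?_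
  refine le_of_sq_le_sq ?_ (mul_nonneg (hα j) (norm_nonneg _))
  rw [mul_pow, hb.norm_sq_linearCombination, Finset.mul_sum]
  classical
  have h2 : ∑ i ∈ c.support, (c i * a j i) • g j i =
      Finsupp.linearCombination 𝕜 (g j)
        (Finsupp.onFinset c.support (fun i => c i * a j i) (by
          intro i hi
          rw [Finsupp.mem_support_iff]
          exact left_ne_zero_of_mul hi)) := by
    rw [Finsupp.linearCombination_apply, Finsupp.onFinset_sum _ (by simp)]
  rw [h2, (hg j).norm_sq_linearCombination]
  refine (Finset.sum_le_sum_of_subset_of_nonneg (Finsupp.support_onFinset_subset)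
    (fun _ _ _ => sq_nonneg _)).trans (Finset.sum_le_sum fun i _ => ?_)
  rw [Finsupp.onFinset_apply, norm_mul, mul_pow, mul_comm]
  gcongr
  exact ha j i

/-- Kadec's 1/4 theorem on `[0,1]`. -/
theorem isRieszBasis_expL2_of_abs_sub_le {lam : ℤ → ℝ} {L : ℝ} (hL : L < 1 / 4)
    (h : ∀ k, |lam k - k| ≤ L) :
    IsRieszBasis (𝕜 := ℂ) (fun k : ℤ => expL2 (2 * Real.pi * lam k)) := by
  have hL0 : 0 ≤ L := (abs_nonneg _).trans (h 0)
  have hL1 : |L| ≤ 1 / 4 := by rw [abs_of_nonneg hL0]; exact hL.le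
  have hpi := Real.pi_pos
  obtain ⟨b₀, hb₀⟩ := exists_hilbertBasis_expL2
  -- The phase `e^{iπ(λ_k - k)}` moves the centre of the perturbation to `t = 1/2`, where `|t - 1/2|
  -- ≤ 1/2` on the interval; centred at `0` the argument would be twice as large.
  obtain ⟨b, hb⟩ := b₀.exists_unimodular_smul
    (fun k => Complex.exp (Complex.I * Real.pi * (lam k - k : ℝ)))
    (fun k => norm_exp_I_mul_mul _ _)
  set ε : ℤ → ℂ := fun k => Complex.exp (Complex.I * Real.pi * (lam k - k : ℝ)) with hε
  have hε1 : ∀ k, ‖ε k‖ = 1 := fun k => norm_exp_I_mul_mul _ _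
  let x : ℤ ⊕ ℤ → ℝ := Sum.elim (fun n => 2 * Real.pi * n) (fun n => 2 * Real.pi * n - Real.pi)
  let a : ℤ ⊕ ℤ → ℤ → ℂ := Sum.elim (fun n k => ε k * kadecCos (lam k - k) n)
    (fun n k => ε k * (Complex.I * kadecSin (lam k - k) n))
  let α : ℤ ⊕ ℤ → ℝ := Sum.elim (kadecCos L) (kadecSin L)
  have hα : HasSum α ((1 - Real.cos (Real.pi * L)) + Real.sin (Real.pi * L)) :=
    (hasSum_kadecCos_eq hL1).sum (f := α) (hasSum_kadecSin_eq hL1)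
  have hα0 : ∀ j, 0 ≤ α j := by
    rintro (n | n)
    · exact kadecCos_nonneg hL0 hL.le n
    · exact kadecSin_nonneg hL0 hL.le n
  have ha : ∀ j k, ‖a j k‖ ≤ α j := by
    rintro (n | n) k
    · change ‖ε k * kadecCos (lam k - k) n‖ ≤ kadecCos L n
      rw [norm_mul, hε1, one_mul, Complex.norm_real, Real.norm_eq_abs, ← kadecCos_abs,
        abs_of_nonneg (kadecCos_nonneg (abs_nonneg _) ((h k).trans hL.le) n)]
      exact kadecCos_mono (abs_nonneg _) (h k) hL.le n
    · change ‖ε k * (Complex.I * kadecSin (lam k - k) n)‖ ≤ kadecSin L n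
      rw [norm_mul, hε1, one_mul, norm_mul, Complex.norm_I, one_mul, Complex.norm_real,
        Real.norm_eq_abs, ← abs_kadecSin,
        abs_of_nonneg (kadecSin_nonneg (abs_nonneg _) ((h k).trans hL.le) n)]
      exact kadecSin_mono (abs_nonneg _) (h k) hL.le n
  -- Here `L < 1/4` is decisive: it is what makes `1 - cos πL + sin πL` smaller than `1`.
  have hsc : Real.sin (Real.pi * L) < Real.cos (Real.pi * L) := by
    rw [← Real.cos_pi_div_two_sub]
    exact Real.cos_lt_cos_of_nonneg_of_le_pi (by positivity) (by nlinarith) (by nlinarith)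
  refine isRieszBasis_of_norm_sum_sub_le b _ (hα.nonneg hα0)
    (q := (1 - Real.cos (Real.pi * L)) + Real.sin (Real.pi * L)) (by linarith) fun c => ?_
  refine norm_linearCombination_sub_le b.orthonormal
    (g := fun j k => expL2 (2 * Real.pi * k + x j)) (a := a) (fun j => orthonormal_expL2 (x j))
    hα0 ha hα (fun k => ?_) c
  have hb' : b k - expL2 (2 * Real.pi * lam k) =
      BoundedContinuousFunction.toLp 2 ((volume : Measure ℝ).restrict (Set.Icc 0 1)) ℂ
        (ε k • expBCF (2 * Real.pi * k) - expBCF (2 * Real.pi * lam k)) := by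
    rw [map_sub, map_smul, toLp_expBCF, toLp_expBCF, hb, hb₀]
  rw [hb']
  refine hasSum_smul_expL2 (Summable.of_nonneg_of_le (fun _ => norm_nonneg _) (fun j => ha j k)
    hα.summable) _ fun t ht => ?_
  have hk : |lam k - k| ≤ 1 / 4 := (h k).trans hL.le
  have s1 := (hasSum_kadecCos hk ht).mul_left (ε k * expBCF (2 * Real.pi * k) t)
  have s2 := (hasSum_kadecSin hk ht).mul_left (ε k * expBCF (2 * Real.pi * k) t)
  have s3 := HasSum.sum
    (f := fun j => a j k * expBCF (2 * Real.pi * k + x j) t) (a := _) (b := _)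
    (s1.congr_fun fun n => ?_) (s2.congr_fun fun n => ?_)
  · convert s3 using 1
    rw [← mul_add]
    have e1 : (1 : ℂ) - Complex.cos (2 * Real.pi * (lam k - k : ℝ) * (t - 1 / 2)) +
        -(Complex.I * Complex.sin (2 * Real.pi * (lam k - k : ℝ) * (t - 1 / 2))) =
        1 - Complex.exp (2 * Real.pi * (lam k - k : ℝ) * (t - 1 / 2) * Complex.I) := by
      rw [Complex.exp_mul_I]
      ring
    rw [e1, mul_sub, mul_one]
    change ε k * expBCF (2 * Real.pi * k) t - expBCF (2 * Real.pi * lam k) t = _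
    congr 1
    simp only [hε, expBCF_apply]
    rw [← Complex.exp_add, ← Complex.exp_add]
    congr 1
    push_cast
    ring
  · change ε k * kadecCos (lam k - k) n * expBCF (2 * Real.pi * k + 2 * Real.pi * n) t = _
    have : expBCF (2 * Real.pi * k + 2 * Real.pi * n) t = expBCF (2 * Real.pi * k) t *
        Complex.exp (2 * Real.pi * n * Complex.I * t) := by
      simp only [expBCF_apply]
      rw [← Complex.exp_add]
      congr 1
      push_cast
      ring
    rw [this]
    ring
  · change ε k * (Complex.I * kadecSin (lam k - k) n) *
      expBCF (2 * Real.pi * k + (2 * Real.pi * n - Real.pi)) t = _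
    have : expBCF (2 * Real.pi * k + (2 * Real.pi * n - Real.pi)) t = expBCF (2 * Real.pi * k) t *
        Complex.exp ((2 * Real.pi * n - Real.pi) * Complex.I * t) := by
      simp only [expBCF_apply]
      rw [← Complex.exp_add]
      congr 1
      push_cast
      ring
    rw [this]
    ring

/-! ### Contour shift in Poisson's integral -/

/-- The integrand `e^{ixz} (1 - z²)^κ` of Poisson's integral. -/
noncomputable def poissonIntegrand (κ x : ℝ) (z : ℂ) : ℂ :=
  Complex.exp (Complex.I * x * z) * (1 - z ^ 2) ^ (κ : ℂ)

theorem one_sub_sq_re (a v : ℝ) : (1 - ((a : ℂ) + v * Complex.I) ^ 2).re = 1 - a ^ 2 + v ^ 2 := by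
  simp [sq]
  ring

theorem one_sub_sq_im (a v : ℝ) : (1 - ((a : ℂ) + v * Complex.I) ^ 2).im = -(2 * a * v) := by
  simp [sq]
  ring

theorem norm_one_sub_sq_le {a v : ℝ} (ha : 0 ≤ a) (ha1 : a ≤ 1) (hv : 0 ≤ v) :
    ‖1 - ((a : ℂ) + v * Complex.I) ^ 2‖ ≤ (1 + v) ^ 2 := by
  refine (Complex.norm_le_abs_re_add_abs_im _).trans ?_
  rw [one_sub_sq_re, one_sub_sq_im, abs_neg, abs_of_nonneg (by nlinarith),
    abs_of_nonneg (by positivity)]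
  nlinarith

theorem norm_exp_I_mul_mul_complex (x a v : ℝ) :
    ‖Complex.exp (Complex.I * x * (a + v * Complex.I))‖ = Real.exp (-(x * v)) := by
  rw [Complex.norm_exp]
  congr 1
  simp

/-- A bound uniform in `a`, for dominated convergence as `a → 1`. For `κ ≤ 0` one uses `|1 - z²| ≥
2av ≥ v` near the branch point; for `κ > 0` one uses `|1 - z²| ≤ (1 + v)²`. -/
theorem norm_poissonIntegrand_le {κ x a v : ℝ} (hκ : κ ≤ 1) (ha : 1 / 2 ≤ a) (ha1 : a ≤ 1)
    (hv : 0 < v) :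
    ‖poissonIntegrand κ x (a + v * Complex.I)‖ ≤ Real.exp (-(x * v)) * (v ^ κ + (1 + v) ^ 2) := by
  rw [poissonIntegrand, norm_mul, norm_exp_I_mul_mul_complex]
  refine mul_le_mul_of_nonneg_left ?_ (Real.exp_nonneg _)
  have h1 := norm_one_sub_sq_le (by linarith : 0 ≤ a) ha1 hv.le
  have h2 : v ≤ ‖1 - ((a : ℂ) + v * Complex.I) ^ 2‖ := by
    refine le_trans ?_ (Complex.abs_im_le_norm _)
    rw [one_sub_sq_im, abs_neg, abs_of_nonneg (by nlinarith)]
    nlinarith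
  rw [Complex.norm_cpow_real]
  rcases le_or_gt κ 0 with h | h
  · have := Real.rpow_le_rpow_of_nonpos hv h2 h
    nlinarith [sq_nonneg (1 + v)]
  · have h3 : (1 : ℝ) ≤ (1 + v) ^ 2 := by nlinarith
    have h4 := Real.rpow_le_rpow (norm_nonneg _) h1 h.le
    have h5 := Real.rpow_le_rpow_of_exponent_le h3 hκ
    rw [Real.rpow_one] at h5
    have := Real.rpow_nonneg hv.le κ
    linarith

theorem norm_poissonIntegrand_le_of_one_le {κ x a v : ℝ} (hκ : κ ≤ 1) (ha : 0 ≤ a) (ha1 : a ≤ 1)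
    (hv : 1 ≤ v) :
    ‖poissonIntegrand κ x (a + v * Complex.I)‖ ≤ Real.exp (-(x * v)) * (1 + v) ^ 2 := by
  rw [poissonIntegrand, norm_mul, norm_exp_I_mul_mul_complex]
  refine mul_le_mul_of_nonneg_left ?_ (Real.exp_nonneg _)
  have h1 := norm_one_sub_sq_le ha ha1 (by linarith : 0 ≤ v)
  have h2 : 1 ≤ ‖1 - ((a : ℂ) + v * Complex.I) ^ 2‖ := by
    refine le_trans ?_ (Complex.re_le_norm _)
    rw [one_sub_sq_re]
    nlinarith
  rw [Complex.norm_cpow_real]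
  have h5 := Real.rpow_le_rpow_of_exponent_le h2 hκ
  rw [Real.rpow_one] at h5
  exact h5.trans h1

theorem continuousAt_poissonIntegrand {κ x a v : ℝ} (h : 0 < 1 - a ^ 2 + v ^ 2) :
    ContinuousAt (poissonIntegrand κ x) (a + v * Complex.I) := by
  refine ContinuousAt.mul (by fun_prop) (ContinuousAt.cpow (by fun_prop) (by fun_prop) ?_)
  left
  rw [one_sub_sq_re]
  exact h

theorem differentiableAt_poissonIntegrand {κ x a v : ℝ} (h : 0 < 1 - a ^ 2 + v ^ 2) :
    DifferentiableAt ℂ (poissonIntegrand κ x) (a + v * Complex.I) := by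
  refine DifferentiableAt.mul (by fun_prop) (DifferentiableAt.cpow (by fun_prop) (by fun_prop) ?_)
  left
  rw [one_sub_sq_re]
  exact h

theorem poissonIntegrand_imaginary_axis (κ x v : ℝ) :
    poissonIntegrand κ x ((0 : ℝ) + v * Complex.I) =
      ((Real.exp (-(x * v)) * (1 + v ^ 2) ^ κ : ℝ) : ℂ) := by
  rw [poissonIntegrand]
  push_cast
  rw [Complex.ofReal_cpow (by positivity)]
  push_cast
  congr 2
  · linear_combination (x * v : ℂ) * Complex.I_sq
  · linear_combination (-(v : ℂ) ^ 2) * Complex.I_sq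

/-- Cauchy's theorem on `[0,a] × [0,R]`: with `a < 1` one has `Re (1 - z²) > 0`, so the branch cut
is avoided. The integrand is real on the imaginary axis, so that side, traversed in direction `i`,
has no real part. -/
theorem integral_poissonIntegrand_rect (κ x : ℝ) {a : ℝ} (R : ℝ) (ha : 0 ≤ a) (ha1 : a < 1) :
    (∫ t in (0 : ℝ)..a, poissonIntegrand κ x t).re -
      (∫ t in (0 : ℝ)..a, poissonIntegrand κ x (t + R * Complex.I)).re =
      (∫ v in (0 : ℝ)..R, poissonIntegrand κ x (a + v * Complex.I)).im := by
  have h := Complex.integral_boundary_rect_eq_zero_of_differentiableOn (poissonIntegrand κ x) 0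
    (a + R * Complex.I) (by
      intro z hz
      have h1 : z.re ∈ Set.uIcc (0 : ℝ) a := by simpa using hz.1
      rw [Set.uIcc_of_le ha] at h1
      rw [← Complex.re_add_im z]
      refine (differentiableAt_poissonIntegrand ?_).differentiableWithinAt
      nlinarith [h1.1, h1.2, sq_nonneg z.im])
  have hre : ((a : ℂ) + R * Complex.I).re = a := by simp
  have him : ((a : ℂ) + R * Complex.I).im = R := by simp
  rw [hre, him, Complex.zero_re, Complex.zero_im] at h
  simp only [Complex.ofReal_zero, zero_mul, add_zero] at h
  have hL : (∫ v in (0 : ℝ)..R, poissonIntegrand κ x (0 + v * Complex.I)).im = 0 := by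
    have : ∀ v : ℝ, poissonIntegrand κ x (0 + v * Complex.I) =
        ((Real.exp (-(x * v)) * (1 + v ^ 2) ^ κ : ℝ) : ℂ) := fun v => by
      rw [← poissonIntegrand_imaginary_axis, Complex.ofReal_zero]
    simp_rw [this]
    rw [intervalIntegral.integral_ofReal, Complex.ofReal_im]
  have h' := congrArg Complex.re h
  simp only [Complex.sub_re, Complex.add_re, smul_eq_mul, Complex.mul_re, Complex.I_re,
    Complex.I_im, zero_mul, one_mul, zero_sub, Complex.zero_re, hL] at h'
  linarith

theorem intervalIntegrable_one_sub_sq_rpow {κ : ℝ} (hκ : -1 < κ) :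
    IntervalIntegrable (fun t : ℝ => (1 - t ^ 2) ^ κ) volume 0 1 := by
  have h1 : IntervalIntegrable (fun t : ℝ => (1 - t) ^ κ + 1) volume 0 1 := by
    refine IntervalIntegrable.add ?_ intervalIntegrable_const
    have := (intervalIntegral.intervalIntegrable_rpow' (a := 0) (b := 1) hκ).comp_sub_left 1
    simpa using this.symm
  rw [intervalIntegrable_iff_integrableOn_Ioo_of_le zero_le_one] at h1 ⊢
  refine Integrable.mono h1 ?_ ?_
  · refine ContinuousOn.aestronglyMeasurable (fun t ht => ?_) measurableSet_Ioo
    refine (ContinuousAt.rpow (by fun_prop) (by fun_prop) (Or.inl ?_)).continuousWithinAt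
    nlinarith [ht.1, ht.2]
  · refine (ae_restrict_iff' measurableSet_Ioo).2 (Filter.Eventually.of_forall fun t ht => ?_)
    have h2 : 0 < 1 - t := by linarith [ht.2]
    have h3 : 1 - t ≤ 1 - t ^ 2 := by nlinarith [ht.1, ht.2]
    have h4 : 0 < 1 - t ^ 2 := h2.trans_le h3
    have h5 : 0 ≤ (1 - t) ^ κ := Real.rpow_nonneg h2.le _
    rw [Real.norm_of_nonneg (Real.rpow_nonneg h4.le _), Real.norm_of_nonneg (by linarith)]
    rcases le_or_gt κ 0 with h | h
    · linarith [Real.rpow_le_rpow_of_nonpos h2 h3 h]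
    · linarith [Real.rpow_le_one h4.le (by nlinarith [ht.1]) h.le]

theorem poissonIntegrand_ofReal {κ x t : ℝ} (h0 : 0 ≤ t) (h1 : t ≤ 1) :
    poissonIntegrand κ x t = Complex.exp (Complex.I * x * t) * ((1 - t ^ 2) ^ κ : ℝ) := by
  rw [poissonIntegrand, Complex.ofReal_cpow (by nlinarith)]
  push_cast
  rfl

theorem IntervalIntegrable.ofReal_complex {f : ℝ → ℝ} {a b : ℝ}
    (hf : IntervalIntegrable f volume a b) :
    IntervalIntegrable (fun t => (f t : ℂ)) volume a b :=
  ⟨hf.1.ofReal, hf.2.ofReal⟩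

theorem intervalIntegrable_poissonIntegrand {κ : ℝ} (hκ : -1 < κ) (x : ℝ) :
    IntervalIntegrable (fun t : ℝ => poissonIntegrand κ x t) volume 0 1 := by
  have h := (intervalIntegrable_one_sub_sq_rpow hκ).ofReal_complex.continuousOn_mul
    (g := fun t : ℝ => Complex.exp (Complex.I * x * t)) (by fun_prop)
  refine h.congr fun t ht => ?_
  rw [Set.uIoc_of_le zero_le_one] at ht
  exact (poissonIntegrand_ofReal ht.1.le ht.2).symm

theorem integrableOn_poissonIntegrand_bound {κ x : ℝ} (hκ : -1 < κ) (hx : 0 < x) :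
    IntegrableOn (fun v : ℝ => Real.exp (-(x * v)) * (v ^ κ + (1 + v) ^ 2)) (Set.Ioi 0) := by
  have h : ∀ s : ℝ, -1 < s → IntegrableOn (fun v : ℝ => v ^ s * Real.exp (-(x * v))) (Set.Ioi 0) := by
    intro s hs
    simpa [neg_mul] using integrableOn_rpow_mul_exp_neg_mul_rpow hs zero_lt_one hx
  have h1 := ((h κ hκ).add ((h 0 (by norm_num)).add
    (((h 1 (by norm_num)).const_mul 2).add (h 2 (by norm_num)))))
  refine h1.congr_fun (fun v _ => ?_) measurableSet_Ioi
  simp only [Pi.add_apply, Real.rpow_zero, Real.rpow_one, Real.rpow_two]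
  ring

theorem continuousOn_poissonIntegrand_one (κ x : ℝ) :
    ContinuousOn (fun v : ℝ => poissonIntegrand κ x (1 + v * Complex.I)) (Set.Ioi 0) := by
  intro v hv
  have h := continuousAt_poissonIntegrand (κ := κ) (x := x) (a := 1) (v := v)
    (by have : 0 < v := hv; rw [one_pow, sub_self, zero_add]; positivity)
  rw [Complex.ofReal_one] at h
  exact (ContinuousAt.comp (f := fun v : ℝ => (1 : ℂ) + v * Complex.I) h
    (by fun_prop)).continuousWithinAt

theorem integrableOn_poissonIntegrand_one {κ x : ℝ} (hκ : -1 < κ) (hκ1 : κ ≤ 1) (hx : 0 < x) :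
    IntegrableOn (fun v : ℝ => poissonIntegrand κ x (1 + v * Complex.I)) (Set.Ioi 0) := by
  refine Integrable.mono' (integrableOn_poissonIntegrand_bound hκ hx)
    ((continuousOn_poissonIntegrand_one κ x).aestronglyMeasurable measurableSet_Ioi) ?_
  refine (ae_restrict_iff' measurableSet_Ioi).2 (Filter.Eventually.of_forall fun v hv => ?_)
  have := norm_poissonIntegrand_le (κ := κ) (x := x) (a := 1) hκ1 (by norm_num) le_rfl hv
  simpa using this

open Filter Topology in
theorem tendsto_integral_poissonIntegrand_right {κ x : ℝ} (hκ : -1 < κ) (hκ1 : κ ≤ 1) (hx : 0 < x) :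
    Tendsto (fun n : ℕ => ∫ v in (0 : ℝ)..(n + 1 : ℝ),
      poissonIntegrand κ x ((1 - 1 / ((n : ℝ) + 2) : ℝ) + v * Complex.I)) atTop
      (𝓝 (∫ v in Set.Ioi (0 : ℝ), poissonIntegrand κ x (1 + v * Complex.I))) := by
  -- The denominator `n + 2` keeps the abscissa at least `1/2`, as the dominating bound requires.
  have ha : ∀ n : ℕ, 1 / 2 ≤ 1 - 1 / ((n : ℝ) + 2) ∧ 1 - 1 / ((n : ℝ) + 2) < 1 := by
    intro n
    have h1 : 1 / ((n : ℝ) + 2) ≤ 1 / 2 :=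
      one_div_le_one_div_of_le two_pos (by linarith [(Nat.cast_nonneg n : (0 : ℝ) ≤ n)])
    have h2 : 0 < 1 / ((n : ℝ) + 2) := by positivity
    constructor <;> linarith
  have halim : Tendsto (fun n : ℕ => 1 - 1 / ((n : ℝ) + 2)) atTop (𝓝 1) := by
    have h := (tendsto_const_nhds (x := (1 : ℝ))).sub
      ((tendsto_one_div_add_atTop_nhds_zero_nat (𝕜 := ℝ)).comp (tendsto_add_atTop_nat 1))
    rw [sub_zero] at h
    refine h.congr fun n => ?_
    simp only [Function.comp, Nat.cast_add, Nat.cast_one]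
    ring
  have heq : ∀ n : ℕ, ∫ v in (0 : ℝ)..(n + 1 : ℝ),
      poissonIntegrand κ x ((1 - 1 / ((n : ℝ) + 2) : ℝ) + v * Complex.I) =
      ∫ v in Set.Ioi (0 : ℝ), (Set.Iic (n + 1 : ℝ)).indicator (fun v : ℝ =>
        poissonIntegrand κ x ((1 - 1 / ((n : ℝ) + 2) : ℝ) + v * Complex.I)) v := by
    intro n
    rw [intervalIntegral.integral_of_le (by positivity), setIntegral_indicator measurableSet_Iic]
    rfl
  simp_rw [heq]
  refine tendsto_integral_of_dominated_convergence _ (fun n => ?_)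
    (integrableOn_poissonIntegrand_bound hκ hx) (fun n => ?_) ?_
  · refine (Continuous.aestronglyMeasurable ?_).indicator measurableSet_Iic
    refine continuous_iff_continuousAt.2 fun v => ?_
    refine ContinuousAt.comp (g := poissonIntegrand κ x)
      (f := fun v : ℝ => ((1 - 1 / ((n : ℝ) + 2) : ℝ) : ℂ) + v * Complex.I)
      (continuousAt_poissonIntegrand ?_) (by fun_prop)
    nlinarith [(ha n).1, (ha n).2, sq_nonneg v]
  · refine (ae_restrict_iff' measurableSet_Ioi).2 (Eventually.of_forall fun v hv => ?_)
    refine (norm_indicator_le_norm_self _ _).trans ?_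
    exact norm_poissonIntegrand_le hκ1 (ha n).1 (ha n).2.le hv
  · refine (ae_restrict_iff' measurableSet_Ioi).2 (Eventually.of_forall fun v hv => ?_)
    have hv0 : 0 < v := hv
    have h := continuousAt_poissonIntegrand (κ := κ) (x := x) (a := 1) (v := v)
      (by rw [one_pow, sub_self, zero_add]; positivity)
    rw [Complex.ofReal_one] at h
    have h2 : Tendsto (fun n : ℕ => ((1 - 1 / ((n : ℝ) + 2) : ℝ) : ℂ) + v * Complex.I) atTop
        (𝓝 (1 + v * Complex.I)) := by
      have := ((Complex.continuous_ofReal.tendsto 1).comp halim).add_const (v * Complex.I)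
      rwa [Complex.ofReal_one] at this
    refine (h.tendsto.comp h2).congr' ?_
    filter_upwards [eventually_ge_atTop ⌈v⌉₊] with n hn
    rw [Set.indicator_of_mem]
    · rfl
    · have := Nat.le_of_ceil_le hn
      exact this.trans (by linarith)

open Filter Topology in
theorem tendsto_integral_poissonIntegrand_top {κ x : ℝ} (hκ1 : κ ≤ 1) (hx : 0 < x) :
    Tendsto (fun n : ℕ => ∫ t in (0 : ℝ)..(1 - 1 / ((n : ℝ) + 2)),
      poissonIntegrand κ x (t + (n + 1 : ℝ) * Complex.I)) atTop (𝓝 0) := by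
  have hlim : Tendsto (fun n : ℕ => Real.exp (-(x * (n + 1 : ℝ))) * (1 + (n + 1 : ℝ)) ^ 2)
      atTop (𝓝 0) := by
    have h0 := (tendsto_rpow_mul_exp_neg_mul_atTop_nhds_zero 2 x hx).comp
      (tendsto_natCast_atTop_atTop.comp (tendsto_add_atTop_nat 2))
    have h1 := h0.mul_const (Real.exp x)
    rw [zero_mul] at h1
    refine h1.congr fun n => ?_
    simp only [Function.comp, Nat.cast_add, Nat.cast_ofNat, Real.rpow_two]
    rw [mul_assoc, ← Real.exp_add, mul_comm]
    congr 2 <;> ring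
  refine squeeze_zero_norm (fun n => ?_) hlim
  have hn : (0 : ℝ) ≤ n := Nat.cast_nonneg n
  have h2 : 0 < 1 / ((n : ℝ) + 2) := by positivity
  have h3 : 1 / ((n : ℝ) + 2) ≤ 1 := by
    rw [div_le_one (by positivity)]
    linarith
  refine (intervalIntegral.norm_integral_le_of_norm_le_const
    (C := Real.exp (-(x * (n + 1 : ℝ))) * (1 + (n + 1 : ℝ)) ^ 2) fun t ht => ?_).trans ?_
  · rw [Set.uIoc_of_le (by linarith)] at ht
    exact norm_poissonIntegrand_le_of_one_le hκ1 ht.1.le (by linarith [ht.2]) (by linarith)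
  · refine mul_le_of_le_one_right (by positivity) ?_
    rw [abs_of_nonneg] <;> linarith

open Filter Topology in
theorem integral_poissonIntegrand_re {κ x : ℝ} (hκ : -1 < κ) (hκ1 : κ ≤ 1) (hx : 0 < x) :
    (∫ t in (0 : ℝ)..1, poissonIntegrand κ x t).re =
      (∫ v in Set.Ioi (0 : ℝ), poissonIntegrand κ x (1 + v * Complex.I)).im := by
  have halim : Tendsto (fun n : ℕ => 1 - 1 / ((n : ℝ) + 2)) atTop (𝓝[Set.uIcc 0 1] 1) := by
    refine tendsto_nhdsWithin_iff.2 ⟨?_, Eventually.of_forall fun n => ?_⟩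
    · have h := (tendsto_const_nhds (x := (1 : ℝ))).sub
        ((tendsto_one_div_add_atTop_nhds_zero_nat (𝕜 := ℝ)).comp (tendsto_add_atTop_nat 1))
      rw [sub_zero] at h
      refine h.congr fun n => ?_
      simp only [Function.comp, Nat.cast_add, Nat.cast_one]
      ring
    · have hn : (0 : ℝ) ≤ n := Nat.cast_nonneg n
      have h2 : 0 < 1 / ((n : ℝ) + 2) := by positivity
      have h3 : 1 / ((n : ℝ) + 2) ≤ 1 := by
        rw [div_le_one (by positivity)]
        linarith
      rw [Set.uIcc_of_le zero_le_one]
      constructor <;> linarith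
  have hA := (intervalIntegral.continuousOn_primitive_interval'
    (intervalIntegrable_poissonIntegrand hκ x) Set.left_mem_uIcc 1 Set.right_mem_uIcc).tendsto.comp halim
  have hT := tendsto_integral_poissonIntegrand_top hκ1 hx
  have hR := tendsto_integral_poissonIntegrand_right hκ hκ1 hx
  have h1 := ((Complex.continuous_re.tendsto _).comp hA).sub
    ((Complex.continuous_re.tendsto _).comp hT)
  rw [Complex.zero_re, sub_zero] at h1
  refine tendsto_nhds_unique h1 (((Complex.continuous_im.tendsto _).comp hR).congr fun n => ?_)
  have hn : (0 : ℝ) ≤ n := Nat.cast_nonneg n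
  have h2 : 0 < 1 / ((n : ℝ) + 2) := by positivity
  have h3 : 1 / ((n : ℝ) + 2) ≤ 1 := by
    rw [div_le_one (by positivity)]
    linarith
  exact (integral_poissonIntegrand_rect κ x _ (by linarith) (by linarith)).symm

theorem integral_cos_mul_rpow_eq_re {κ : ℝ} (hκ : -1 < κ) (x : ℝ) :
    ∫ t in (0 : ℝ)..1, Real.cos (x * t) * (1 - t ^ 2) ^ κ =
      (∫ t in (0 : ℝ)..1, poissonIntegrand κ x t).re := by
  have h := Complex.reCLM.intervalIntegral_comp_comm (intervalIntegrable_poissonIntegrand hκ x)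
  simp only [Complex.reCLM_apply] at h
  rw [← h]
  refine intervalIntegral.integral_congr fun t ht => ?_
  rw [Set.uIcc_of_le zero_le_one] at ht
  rw [poissonIntegrand_ofReal ht.1 ht.2, Complex.re_mul_ofReal,
    show Complex.I * x * t = ((x * t : ℝ) : ℂ) * Complex.I by push_cast; ring,
    Complex.exp_ofReal_mul_I_re]

/-- At `z = 1 + iv` one has `1 - z² = v² - 2iv`, in the open fourth quadrant. With argument `-θ` the
integrand has phase `x - κθ` and positive modulus. -/
theorem poissonIntegrand_one_im (κ x : ℝ) {v : ℝ} (hv : 0 < v) :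
    ∃ θ ∈ Set.Ioo 0 (Real.pi / 2), ∃ r > 0,
      (poissonIntegrand κ x (1 + v * Complex.I)).im = r * Real.sin (x - κ * θ) := by
  have hre := one_sub_sq_re 1 v
  have him := one_sub_sq_im 1 v
  rw [Complex.ofReal_one] at hre him
  set w : ℂ := 1 - (1 + v * Complex.I) ^ 2 with hw
  have hre' : 0 < w.re := by rw [hre]; nlinarith
  have him' : w.im < 0 := by rw [him]; linarith
  have hw0 : w ≠ 0 := fun h => by rw [h] at hre'; exact lt_irrefl _ hre'
  have harg := Complex.abs_arg_lt_pi_div_two_iff.2 (Or.inl hre')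
  have harg2 := Complex.arg_neg_iff.2 him'
  refine ⟨-w.arg, ⟨by linarith, by rw [abs_lt] at harg; linarith⟩,
    Real.exp (-(x * v)) * ‖w‖ ^ κ, by positivity, ?_⟩
  have h1 : w ^ (κ : ℂ) = ((‖w‖ ^ κ : ℝ) : ℂ) * Complex.exp ((κ * w.arg : ℝ) * Complex.I) := by
    rw [Complex.cpow_def_of_ne_zero hw0, Complex.log, add_mul, Complex.exp_add,
      Real.rpow_def_of_pos (norm_pos_iff.2 hw0)]
    push_cast
    congr 2
    ring
  have h2 : Complex.exp (Complex.I * x * (1 + v * Complex.I)) =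
      ((Real.exp (-(x * v)) : ℝ) : ℂ) * Complex.exp ((x : ℝ) * Complex.I) := by
    push_cast
    rw [← Complex.exp_add]
    congr 1
    linear_combination (x * v : ℂ) * Complex.I_sq
  have h3 : poissonIntegrand κ x (1 + v * Complex.I) =
      ((Real.exp (-(x * v)) * ‖w‖ ^ κ : ℝ) : ℂ) *
        Complex.exp ((x - κ * -w.arg : ℝ) * Complex.I) := by
    rw [poissonIntegrand, ← hw, h1, h2, mul_mul_mul_comm, ← Complex.exp_add]
    push_cast
    congr 2
    ring
  rw [h3, Complex.im_ofReal_mul, Complex.exp_ofReal_mul_I_im]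

/-- The sign of Poisson's integral, read off from its Hankel-type form. -/
theorem mul_integral_cos_mul_rpow_pos {κ x s : ℝ} (hκ : -1 < κ) (hκ1 : κ ≤ 1) (hx : 0 < x)
    (h : ∀ θ ∈ Set.Ioo 0 (Real.pi / 2), 0 < s * Real.sin (x - κ * θ)) :
    0 < s * ∫ t in (0 : ℝ)..1, Real.cos (x * t) * (1 - t ^ 2) ^ κ := by
  have hi := integrableOn_poissonIntegrand_one hκ hκ1 hx
  have hcomm := Complex.imCLM.integral_comp_comm hi
  simp only [Complex.imCLM_apply] at hcomm
  rw [integral_cos_mul_rpow_eq_re hκ, integral_poissonIntegrand_re hκ hκ1 hx, ← hcomm,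
    ← integral_const_mul]
  have hpos : ∀ v ∈ Set.Ioi (0 : ℝ), 0 < s * (poissonIntegrand κ x (1 + v * Complex.I)).im := by
    intro v hv
    obtain ⟨θ, hθ, r, hr, he⟩ := poissonIntegrand_one_im κ x hv
    rw [he, mul_left_comm]
    exact mul_pos hr (h θ hθ)
  have hint : IntegrableOn (fun v : ℝ => s * (poissonIntegrand κ x (1 + v * Complex.I)).im)
      (Set.Ioi 0) := (Complex.imCLM.integrable_comp hi).const_mul s
  rw [setIntegral_pos_iff_support_of_nonneg_ae
    ((ae_restrict_iff' measurableSet_Ioi).2 (Filter.Eventually.of_forall fun v hv =>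
      (hpos v hv).le)) hint]
  refine lt_of_lt_of_le ?_ (measure_mono (s := Set.Ioi (0 : ℝ)) fun v hv =>
    ⟨(hpos v hv).ne', hv⟩)
  simp

/-! ### Poisson's integral as a Bessel series, and its sign -/

/-- The substitution `y = t²` turns twice the integral into the Beta integral `B(m + 1/2, κ + 1)`.
-/
theorem integral_pow_mul_one_sub_sq_rpow {κ : ℝ} (hκ : -1 < κ) (m : ℕ) :
    ∫ t in (0 : ℝ)..1, t ^ (2 * m) * (1 - t ^ 2) ^ κ =
      Real.Gamma (m + 1 / 2) * Real.Gamma (κ + 1) / (2 * Real.Gamma (m + κ + 3 / 2)) := by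
  have hbeta := ProbabilityTheory.beta_eq_betaIntegralReal (m + 1 / 2) (κ + 1) (by positivity)
    (by linarith)
  have h1 : Complex.betaIntegral ((m + 1 / 2 : ℝ) : ℂ) ((κ + 1 : ℝ) : ℂ) =
      ((∫ y in Set.Ioo (0 : ℝ) 1, y ^ ((m : ℝ) - 1 / 2) * (1 - y) ^ κ : ℝ) : ℂ) := by
    rw [Complex.betaIntegral, intervalIntegral.integral_of_le zero_le_one,
      integral_Ioc_eq_integral_Ioo, ← integral_complex_ofReal]
    refine setIntegral_congr_fun measurableSet_Ioo fun y hy => ?_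
    rw [Complex.ofReal_mul, Complex.ofReal_cpow hy.1.le, Complex.ofReal_cpow (by linarith [hy.2])]
    push_cast
    congr 2
    · ring
    · ring
  have himage : (fun t : ℝ => t ^ 2) '' Set.Ioo 0 1 = Set.Ioo 0 1 := by
    ext y
    constructor
    · rintro ⟨t, ht, rfl⟩
      exact ⟨by have := ht.1; positivity, by nlinarith [ht.1, ht.2]⟩
    · intro hy
      exact ⟨√y, ⟨Real.sqrt_pos.2 hy.1, by rw [Real.sqrt_lt' one_pos]; simpa using hy.2⟩,
        Real.sq_sqrt hy.1.le⟩
  have h2 : ∫ y in Set.Ioo (0 : ℝ) 1, y ^ ((m : ℝ) - 1 / 2) * (1 - y) ^ κ =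
      2 * ∫ t in (0 : ℝ)..1, t ^ (2 * m) * (1 - t ^ 2) ^ κ := by
    conv_lhs => rw [← himage]
    rw [integral_image_eq_integral_abs_deriv_smul (f' := fun t => 2 * t) measurableSet_Ioo
      (fun t _ => by simpa using (hasDerivAt_pow 2 t).hasDerivWithinAt)
      (fun s hs t ht hst => by
        exact (pow_left_inj₀ hs.1.le ht.1.le two_ne_zero).1 hst),
      intervalIntegral.integral_of_le zero_le_one, integral_Ioc_eq_integral_Ioo,
      ← integral_const_mul]
    refine setIntegral_congr_fun measurableSet_Ioo fun t ht => ?_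
    have ht0 : 0 < t := ht.1
    simp only [smul_eq_mul]
    rw [abs_of_pos (by linarith), ← Real.rpow_natCast t 2, ← Real.rpow_mul ht0.le,
      ← Real.rpow_natCast t (2 * m)]
    have : t * t ^ (((2 : ℕ) : ℝ) * ((m : ℝ) - 1 / 2)) = t ^ (((2 * m : ℕ) : ℝ)) := by
      nth_rewrite 1 [← Real.rpow_one t]
      rw [← Real.rpow_add ht0]
      congr 1
      push_cast
      ring
    rw [← this]
    ring
  rw [h1, Complex.ofReal_re, h2, ProbabilityTheory.beta] at hbeta
  rw [show (m : ℝ) + κ + 3 / 2 = m + 1 / 2 + (κ + 1) by ring, mul_comm (2 : ℝ), ← div_div, hbeta]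
  ring

/-- Legendre's duplication formula at `m + 1/2`. -/
theorem Gamma_nat_add_half_mul_factorial (m : ℕ) :
    Real.Gamma (m + 1 / 2) * m.factorial * 4 ^ m = (2 * m).factorial * √Real.pi := by
  have h := Real.Gamma_mul_Gamma_add_half ((m : ℝ) + 1 / 2)
  rw [show (m : ℝ) + 1 / 2 + 1 / 2 = m + 1 by ring,
    show 2 * ((m : ℝ) + 1 / 2) = ((2 * m : ℕ) : ℝ) + 1 by push_cast; ring,
    Real.Gamma_nat_eq_factorial, Real.Gamma_nat_eq_factorial,
    show (1 : ℝ) - (((2 * m : ℕ) : ℝ) + 1) = -((2 * m : ℕ) : ℝ) by ring,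
    Real.rpow_neg two_pos.le, Real.rpow_natCast, pow_mul] at h
  rw [h]
  norm_num
  field_simp

/-- The even entire factor `∑ (-1)^m / (m! Γ(m + ν + 1)) (x/2)^(2m)` of the Bessel function `J_ν`. -/
noncomputable def besselSeries (ν x : ℝ) : ℝ :=
  ∑' m : ℕ, (-1) ^ m / ((m.factorial : ℝ) * Real.Gamma (m + ν + 1)) * (x / 2) ^ (2 * m)

/-- Expand the cosine and integrate termwise; `∑ |x|^(2m) / (2m)!` times the weight dominates. -/
theorem hasSum_poisson {κ : ℝ} (hκ : -1 < κ) (x : ℝ) :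
    HasSum (fun m : ℕ => (-1) ^ m / ((m.factorial : ℝ) * Real.Gamma (m + (κ + 1 / 2) + 1)) *
        (x / 2) ^ (2 * m) * (√Real.pi * Real.Gamma (κ + 1) / 2))
      (∫ t in (0 : ℝ)..1, Real.cos (x * t) * (1 - t ^ 2) ^ κ) := by
  have hint := intervalIntegrable_one_sub_sq_rpow hκ
  have hs : Summable fun m : ℕ => |x| ^ (2 * m) / (2 * m).factorial :=
    (Real.summable_pow_div_factorial |x|).comp_injective (mul_right_injective₀ two_ne_zero)
  have h := intervalIntegral.hasSum_integral_of_dominated_convergence (a := 0) (b := 1)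
    (μ := volume)
    (F := fun (m : ℕ) (t : ℝ) => (-1) ^ m * (x * t) ^ (2 * m) / (2 * m).factorial * (1 - t ^ 2) ^ κ)
    (f := fun t : ℝ => Real.cos (x * t) * (1 - t ^ 2) ^ κ)
    (fun m t => |x| ^ (2 * m) / (2 * m).factorial * (1 - t ^ 2) ^ κ)
    (fun m => by
      have := (hint.continuousOn_mul
        (g := fun t : ℝ => (-1) ^ m * (x * t) ^ (2 * m) / (2 * m).factorial) (by fun_prop))
      exact this.def'.aestronglyMeasurable)
    (fun m => Filter.Eventually.of_forall fun t ht => by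
      rw [Set.uIoc_of_le zero_le_one] at ht
      have h0 : 0 ≤ (1 - t ^ 2) ^ κ := Real.rpow_nonneg (by nlinarith [ht.1, ht.2]) _
      rw [norm_mul, Real.norm_of_nonneg h0]
      refine mul_le_mul_of_nonneg_right ?_ h0
      rw [norm_div, norm_mul, norm_pow, norm_neg, norm_one, one_pow, one_mul, norm_pow,
        Real.norm_natCast]
      gcongr
      rw [norm_mul, Real.norm_eq_abs, Real.norm_of_nonneg ht.1.le]
      exact mul_le_of_le_one_right (abs_nonneg _) ht.2)
    (Filter.Eventually.of_forall fun t _ => hs.mul_right _)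
    (by
      simp_rw [tsum_mul_right]
      exact hint.const_mul _)
    (Filter.Eventually.of_forall fun t _ => (Real.hasSum_cos (x * t)).mul_right _)
  refine h.congr_fun fun m => ?_
  have e1 : ∀ t : ℝ, (-1) ^ m * (x * t) ^ (2 * m) / (2 * m).factorial * (1 - t ^ 2) ^ κ =
      (-1) ^ m * x ^ (2 * m) / (2 * m).factorial * (t ^ (2 * m) * (1 - t ^ 2) ^ κ) := by
    intro t
    rw [mul_pow]
    ring
  simp_rw [e1]
  rw [intervalIntegral.integral_const_mul, integral_pow_mul_one_sub_sq_rpow hκ]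
  have e2 := Gamma_nat_add_half_mul_factorial m
  have e3 : Real.Gamma (m + 1 / 2) = (2 * m).factorial * √Real.pi / (m.factorial * 4 ^ m) := by
    rw [eq_div_iff (by positivity), ← e2]
    ring
  rw [e3, div_pow x, pow_mul 2 2 m, show (2 : ℝ) ^ 2 = 4 by norm_num,
    show (m : ℝ) + (κ + 1 / 2) + 1 = m + κ + 3 / 2 by ring]
  have hG : Real.Gamma (m + κ + 3 / 2) ≠ 0 :=
    (Real.Gamma_pos_of_pos (by have : (0 : ℝ) ≤ m := Nat.cast_nonneg m; linarith)).ne'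
  field_simp

theorem integral_cos_mul_rpow_eq_besselSeries {ν : ℝ} (hν : -(1 / 2) < ν) (x : ℝ) :
    ∫ t in (0 : ℝ)..1, Real.cos (x * t) * (1 - t ^ 2) ^ (ν - 1 / 2) =
      √Real.pi * Real.Gamma (ν + 1 / 2) / 2 * besselSeries ν x := by
  have h := (hasSum_poisson (κ := ν - 1 / 2) (by linarith) x).tsum_eq
  rw [tsum_mul_right, sub_add_cancel, show ν - 1 / 2 + 1 = ν + 1 / 2 by ring] at h
  rw [← h, besselSeries, mul_comm]

theorem mul_besselSeries_pos {ν x s : ℝ} (hν : -(1 / 2) < ν) (hν1 : ν ≤ 3 / 2) (hx : 0 < x)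
    (h : ∀ θ ∈ Set.Ioo 0 (Real.pi / 2), 0 < s * Real.sin (x - (ν - 1 / 2) * θ)) :
    0 < s * besselSeries ν x := by
  have h1 := mul_integral_cos_mul_rpow_pos (κ := ν - 1 / 2) (by linarith) (by linarith) hx h
  rw [integral_cos_mul_rpow_eq_besselSeries hν, mul_left_comm] at h1
  have hG := Real.Gamma_pos_of_pos (show 0 < ν + 1 / 2 by linarith)
  exact pos_of_mul_pos_right h1 (by positivity)

/-- For `x ≤ 1` the factor `cos (xt)` is already positive. This excludes zeros in the band at `k =
0`, where the contour criterion is silent. -/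
theorem besselSeries_pos {ν x : ℝ} (hν : -(1 / 2) < ν) (hx : 0 ≤ x) (hx1 : x ≤ 1) :
    0 < besselSeries ν x := by
  have hG := Real.Gamma_pos_of_pos (show 0 < ν + 1 / 2 by linarith)
  have h1 : 0 < ∫ t in (0 : ℝ)..1, Real.cos (x * t) * (1 - t ^ 2) ^ (ν - 1 / 2) := by
    refine intervalIntegral.intervalIntegral_pos_of_pos_on
      ((intervalIntegrable_one_sub_sq_rpow (by linarith)).continuousOn_mul (by fun_prop))
      (fun t ht => ?_) zero_lt_one
    have h2 : x * t ≤ 1 := by nlinarith [ht.1, ht.2]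
    have h3 : 0 ≤ x * t := mul_nonneg hx ht.1.le
    exact mul_pos (Real.cos_pos_of_mem_Ioo ⟨by linarith [Real.pi_pos],
      by linarith [Real.pi_gt_three]⟩) (Real.rpow_pos_of_pos (by nlinarith [ht.1, ht.2]) _)
  rw [integral_cos_mul_rpow_eq_besselSeries hν] at h1
  exact pos_of_mul_pos_right h1 (by positivity)

theorem besselSeries_neg (ν x : ℝ) : besselSeries ν (-x) = besselSeries ν x := by
  simp only [besselSeries, neg_div, (even_two_mul _).neg_pow]

/-! ### Derivative and recurrence of the Bessel series -/

theorem exists_pos_le_Gamma_nat_add {ν : ℝ} (hν : -1 < ν) :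
    ∃ c > 0, ∀ m : ℕ, c ≤ Real.Gamma (m + ν + 1) := by
  have h1 := Real.Gamma_pos_of_pos (show 0 < ν + 1 by linarith)
  have h2 := Real.Gamma_pos_of_pos (show 0 < ν + 2 by linarith)
  have h3 : ∀ m : ℕ, Real.Gamma (ν + 2) ≤ Real.Gamma ((m + 1 : ℕ) + ν + 1) := by
    intro m
    induction m with
    | zero =>
      refine le_of_eq ?_
      congr 1
      push_cast
      ring
    | succ k ih =>
      have hk : (0 : ℝ) ≤ k := Nat.cast_nonneg k
      have hpos : (0 : ℝ) < (k + 1 : ℕ) + ν + 1 := by push_cast; linarith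
      rw [show (((k + 1 + 1 : ℕ) : ℝ) + ν + 1) = ((k + 1 : ℕ) + ν + 1) + 1 by push_cast; ring,
        Real.Gamma_add_one hpos.ne']
      refine ih.trans (le_mul_of_one_le_left (Real.Gamma_pos_of_pos hpos).le ?_)
      push_cast
      linarith
  -- The first step multiplies by `ν + 1`, which may be below `1`; all later factors are at least
  -- `1`. So the minimum of the first two values is a lower bound.
  refine ⟨min (Real.Gamma (ν + 1)) (Real.Gamma (ν + 2)), lt_min h1 h2, fun m => ?_⟩
  cases m with
  | zero => simp
  | succ k => exact (min_le_right _ _).trans (h3 k)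

theorem exists_abs_besselCoeff_le {ν : ℝ} (hν : -1 < ν) :
    ∃ C, ∀ m : ℕ, |(-1) ^ m / ((m.factorial : ℝ) * Real.Gamma (m + ν + 1))| ≤ C / m.factorial := by
  obtain ⟨c, hc, h⟩ := exists_pos_le_Gamma_nat_add hν
  refine ⟨1 / c, fun m => ?_⟩
  have hG := hc.trans_le (h m)
  rw [abs_div, abs_pow, abs_neg, abs_one, one_pow, abs_of_pos (by positivity), div_div]
  refine one_div_le_one_div_of_le (by positivity) ?_
  rw [mul_comm]
  exact mul_le_mul_of_nonneg_left (h m) (by positivity)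

theorem summable_besselSeries {ν : ℝ} (hν : -1 < ν) (x : ℝ) :
    Summable fun m : ℕ =>
      (-1) ^ m / ((m.factorial : ℝ) * Real.Gamma (m + ν + 1)) * (x / 2) ^ (2 * m) := by
  obtain ⟨C, hC⟩ := exists_abs_besselCoeff_le hν
  refine Summable.of_norm_bounded
    ((Real.summable_pow_div_factorial ((x / 2) ^ 2)).mul_left C) fun m => ?_
  rw [norm_mul, Real.norm_eq_abs, pow_mul, norm_pow, Real.norm_of_nonneg (sq_nonneg _),
    mul_div_left_comm, mul_comm]
  exact mul_le_mul_of_nonneg_left (hC m) (by positivity)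

theorem hasDerivAt_besselSeries_tsum {ν : ℝ} (hν : -1 < ν) (x : ℝ) :
    HasDerivAt (besselSeries ν)
      (∑' m : ℕ, (-1) ^ m / ((m.factorial : ℝ) * Real.Gamma (m + ν + 1)) *
        (m * (x / 2) ^ (2 * m - 1))) x ∧
    Summable fun m : ℕ => (-1) ^ m / ((m.factorial : ℝ) * Real.Gamma (m + ν + 1)) *
        (m * (x / 2) ^ (2 * m - 1)) := by
  obtain ⟨C, hC⟩ := exists_abs_besselCoeff_le hν
  have hC0 : 0 ≤ C := by
    have := (abs_nonneg _).trans (hC 0)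
    simpa using this
  -- Truncated subtraction in `2 * m - 1` matters only at `m = 0`, where the factor `m` kills the
  -- term.
  set R : ℝ := |x| + 1 with hR
  have hu : Summable fun m : ℕ => C / m.factorial * (m * (R / 2) ^ (2 * m - 1)) := by
    rw [← summable_nat_add_iff 1]
    refine ((Real.summable_pow_div_factorial ((R / 2) ^ 2)).mul_left (C * (R / 2))).congr fun m => ?_
    rw [show 2 * (m + 1) - 1 = 2 * m + 1 by omega, pow_succ _ (2 * m), pow_mul, Nat.factorial_succ]
    push_cast
    have : (m : ℝ) + 1 ≠ 0 := by positivity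
    field_simp
  have hb : ∀ (m : ℕ) (y : ℝ), y ∈ Set.Ioo (-R) R →
      ‖(-1) ^ m / ((m.factorial : ℝ) * Real.Gamma (m + ν + 1)) * (m * (y / 2) ^ (2 * m - 1))‖ ≤
      C / m.factorial * (m * (R / 2) ^ (2 * m - 1)) := by
    intro m y hy
    rw [norm_mul, Real.norm_eq_abs, norm_mul, Real.norm_natCast, norm_pow, norm_div,
      Real.norm_eq_abs y, Real.norm_two]
    have : |y| ≤ R := (abs_lt.2 hy).le
    gcongr
    exact hC m
  have hx : x ∈ Set.Ioo (-R) R := abs_lt.1 (by linarith)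
  refine ⟨hasDerivAt_tsum_of_isPreconnected hu isOpen_Ioo isPreconnected_Ioo (fun m y _ => ?_) hb hx
    (summable_besselSeries hν x) hx, Summable.of_norm_bounded hu fun m => hb m x hx⟩
  have h := (((hasDerivAt_id y).div_const 2).pow (2 * m)).const_mul
    ((-1) ^ m / ((m.factorial : ℝ) * Real.Gamma (m + ν + 1)))
  refine h.congr_deriv ?_
  push_cast
  simp only [id]
  ring

/-- This is `(z^(-ν) J_ν)' = -z^(-ν) J_{ν+1}`, obtained by shifting the summation index. -/
theorem hasDerivAt_besselSeries_eq {ν : ℝ} (hν : -1 < ν) (x : ℝ) :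
    HasDerivAt (besselSeries ν) (-(x / 2) * besselSeries (ν + 1) x) x := by
  obtain ⟨h, hs⟩ := hasDerivAt_besselSeries_tsum hν x
  convert h using 1
  rw [hs.tsum_eq_zero_add, besselSeries, ← tsum_mul_left]
  simp only [Nat.cast_zero, zero_mul, mul_zero, zero_add]
  refine tsum_congr fun m => ?_
  rw [show 2 * (m + 1) - 1 = 2 * m + 1 by omega, pow_succ (x / 2), pow_succ (-1 : ℝ),
    Nat.factorial_succ, show ((m + 1 : ℕ) : ℝ) + ν + 1 = m + (ν + 1) + 1 by push_cast; ring]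
  have h1 : Real.Gamma (m + (ν + 1) + 1) ≠ 0 :=
    (Real.Gamma_pos_of_pos (by have : (0 : ℝ) ≤ m := Nat.cast_nonneg m; linarith)).ne'
  push_cast
  have : (m : ℝ) + 1 ≠ 0 := by positivity
  field_simp

/-- Termwise this is `(m + ν) / Γ(m + ν + 1) = 1 / Γ(m + ν)`. It serves to differentiate `z^(2ν)
besselSeries ν z`, the counterpart of `(z^ν J_ν)' = z^ν J_{ν-1}`. -/
theorem besselSeries_sub_one {ν : ℝ} (hν : 0 < ν) (x : ℝ) :
    besselSeries (ν - 1) x = ν * besselSeries ν x - (x / 2) ^ 2 * besselSeries (ν + 1) x := by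
  obtain ⟨h, hs⟩ := hasDerivAt_besselSeries_tsum (by linarith : -1 < ν) x
  have h1 := h.unique (hasDerivAt_besselSeries_eq (by linarith : -1 < ν) x)
  have h2 : (x / 2) ^ 2 * besselSeries (ν + 1) x =
      -((x / 2) * (-(x / 2) * besselSeries (ν + 1) x)) := by ring
  rw [h2, ← h1, sub_neg_eq_add, besselSeries, besselSeries, ← tsum_mul_left, ← tsum_mul_left,
    ← ((summable_besselSeries (by linarith : -1 < ν) x).mul_left ν).tsum_add (hs.mul_left _)]
  refine tsum_congr fun m => ?_
  have hm : (0 : ℝ) ≤ m := Nat.cast_nonneg m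
  have h3 : (m : ℝ) + ν ≠ 0 := by positivity
  have h4 : Real.Gamma (m + ν) ≠ 0 := (Real.Gamma_pos_of_pos (by positivity)).ne'
  rw [show (m : ℝ) + (ν - 1) + 1 = m + ν by ring, Real.Gamma_add_one h3]
  have h5 : (x / 2) * ((m : ℝ) * (x / 2) ^ (2 * m - 1)) = m * (x / 2) ^ (2 * m) := by
    cases m with
    | zero => simp
    | succ k =>
      rw [show 2 * (k + 1) = 2 * k + 1 + 1 by ring, Nat.add_sub_cancel, pow_succ _ (2 * k + 1)]
      ring
  rw [mul_left_comm (x / 2), h5]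
  field_simp
  ring

theorem besselJ_ofReal_eq_zero_iff {ν : ℝ} (hν : 0 < ν) (x : ℝ) :
    besselJ ν x = 0 ↔ x = 0 ∨ besselSeries ν x = 0 := by
  have h : besselJ ν x = ((x : ℂ) / 2) ^ (ν : ℂ) * (besselSeries ν x : ℂ) := by
    rw [besselJ, besselSeries, Complex.ofReal_tsum]
    push_cast
    rfl
  rw [h, mul_eq_zero, Complex.cpow_eq_zero_iff]
  simp [hν.ne']

/-! ### Location and enumeration of the zeros -/

/-- Agreement propagates from `0` in both directions, since the next value must be the nearest point
of the range. Hence proving the basis property for one enumeration proves it for all. -/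
theorem StrictMono.eq_of_range_eq_of_zero_eq {α : Type*} [LinearOrder α] {f g : ℤ → α}
    (hf : StrictMono f) (hg : StrictMono g) (hr : Set.range f = Set.range g) (h0 : f 0 = g 0) :
    f = g := by
  have up : ∀ {f g : ℤ → α}, StrictMono f → StrictMono g → Set.range f = Set.range g →
      ∀ n, f n = g n → g (n + 1) ≤ f (n + 1) := by
    intro f g hf hg hr n hn
    obtain ⟨m, hm⟩ : f (n + 1) ∈ Set.range g := hr ▸ Set.mem_range_self _
    have : g n < g m := by rw [hm, ← hn]; exact hf (by omega)
    have := hg.lt_iff_lt.1 this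
    rw [← hm]
    exact hg.monotone (by omega)
  have down : ∀ {f g : ℤ → α}, StrictMono f → StrictMono g → Set.range f = Set.range g →
      ∀ n, f n = g n → f (n - 1) ≤ g (n - 1) := by
    intro f g hf hg hr n hn
    obtain ⟨m, hm⟩ : f (n - 1) ∈ Set.range g := hr ▸ Set.mem_range_self _
    have : g m < g n := by rw [hm, ← hn]; exact hf (by omega)
    have := hg.lt_iff_lt.1 this
    rw [← hm]
    exact hg.monotone (by omega)
  funext k
  induction k using Int.induction_on with
  | zero => exact h0
  | succ n ih => exact le_antisymm (up hg hf hr.symm _ ih.symm) (up hf hg hr _ ih)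
  | pred n ih => exact le_antisymm (down hf hg hr _ ih) (down hg hf hr.symm _ ih.symm)

theorem neg_one_pow_mul_sin_pos {k : ℕ} {y : ℝ} (h1 : k * Real.pi < y) (h2 : y < (k + 1) * Real.pi) :
    0 < (-1) ^ k * Real.sin y := by
  rw [← Real.sin_sub_nat_mul_pi]
  exact Real.sin_pos_of_pos_of_lt_pi (by linarith) (by linarith)

theorem continuous_besselSeries {ν : ℝ} (hν : -1 < ν) : Continuous (besselSeries ν) :=
  continuous_iff_continuousAt.2 fun x => (hasDerivAt_besselSeries_eq hν x).continuousAt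

/-- The limiting displacement `(ν/2 - 1/4)π` of the zeros of `J_ν` from the multiples of `π`. -/
noncomputable def besselShift (ν : ℝ) : ℝ := (ν - 1 / 2) * (Real.pi / 2)

theorem abs_besselShift_lt {ν : ℝ} (h0 : 0 < ν) (h1 : ν < 1) : |besselShift ν| < Real.pi / 4 := by
  have := Real.pi_pos
  rw [besselShift, abs_lt]
  constructor <;> nlinarith

/-- For `0 < θ < π/2` the number `(ν - 1/2)θ` lies between `0` and `besselShift ν`, so `x - (ν -
1/2)θ` stays in `(kπ, (k + 1)π)`. -/
theorem neg_one_pow_mul_besselSeries_pos {ν x : ℝ} (h0 : 0 < ν) (h1 : ν < 1) (k : ℕ)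
    (hx1 : k * Real.pi + max 0 (besselShift ν) < x)
    (hx2 : x < (k + 1) * Real.pi + min 0 (besselShift ν)) :
    0 < (-1) ^ k * besselSeries ν x := by
  have hpi := Real.pi_pos
  have hx : 0 < x := by
    have : 0 ≤ k * Real.pi := by positivity
    linarith [le_max_left 0 (besselShift ν)]
  refine mul_besselSeries_pos (by linarith) (by linarith) hx fun θ hθ => ?_
  have hb : (ν - 1 / 2) * θ ≤ max 0 (besselShift ν) := by
    rcases le_total ν (1 / 2) with h | h
    · exact le_max_of_le_left (mul_nonpos_of_nonpos_of_nonneg (by linarith) hθ.1.le)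
    · exact le_max_of_le_right (mul_le_mul_of_nonneg_left hθ.2.le (by linarith))
  have ha : min 0 (besselShift ν) ≤ (ν - 1 / 2) * θ := by
    rcases le_total ν (1 / 2) with h | h
    · exact min_le_of_right_le (mul_le_mul_of_nonpos_left hθ.2.le (by linarith))
    · exact min_le_of_left_le (mul_nonneg (by linarith) hθ.1.le)
  exact neg_one_pow_mul_sin_pos (by linarith) (by linarith)

theorem exists_mem_Icc_of_besselSeries_eq_zero {ν x : ℝ} (h0 : 0 < ν) (h1 : ν < 1) (hx : 0 < x)
    (hz : besselSeries ν x = 0) :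
    ∃ k : ℕ, 0 < k ∧
      x ∈ Set.Icc (k * Real.pi + min 0 (besselShift ν)) (k * Real.pi + max 0 (besselShift ν)) := by
  have hpi := Real.pi_pos
  have hc := abs_lt.1 (abs_besselShift_lt h0 h1)
  set n := ⌊x / Real.pi⌋₊ with hn
  have hn1 : n * Real.pi ≤ x := by
    rw [← le_div_iff₀ hpi]
    exact Nat.floor_le (by positivity)
  have hn2 : x < (n + 1) * Real.pi := by
    rw [← div_lt_iff₀ hpi]
    exact Nat.lt_floor_add_one _
  rcases le_or_gt x (n * Real.pi + max 0 (besselShift ν)) with h | h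
  · refine ⟨n, Nat.pos_of_ne_zero fun hn0 => ?_, by linarith [min_le_left 0 (besselShift ν)], h⟩
    have : max 0 (besselShift ν) ≤ 1 := max_le zero_le_one (by linarith [Real.pi_lt_four])
    rw [hn0, Nat.cast_zero, zero_mul, zero_add] at h
    exact (besselSeries_pos (by linarith) hx.le (h.trans this)).ne' hz
  rcases le_or_gt ((n + 1) * Real.pi + min 0 (besselShift ν)) x with h' | h'
  · refine ⟨n + 1, n.succ_pos, by push_cast; exact h', ?_⟩
    push_cast
    linarith [le_max_left 0 (besselShift ν)]
  · have := neg_one_pow_mul_besselSeries_pos h0 h1 n h h'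
    rw [hz, mul_zero] at this
    exact absurd this (lt_irrefl _)

theorem exists_besselSeries_eq_zero {ν : ℝ} (h0 : 0 < ν) (h1 : ν < 1) {k : ℕ} (hk : 0 < k) :
    ∃ x ∈ Set.Icc (k * Real.pi + min 0 (besselShift ν)) (k * Real.pi + max 0 (besselShift ν)),
      besselSeries ν x = 0 := by
  have hpi := Real.pi_pos
  have hc := abs_lt.1 (abs_besselShift_lt h0 h1)
  have hmax : max 0 (besselShift ν) < Real.pi / 4 := max_lt (by positivity) hc.2
  have hmin : -(Real.pi / 4) < min 0 (besselShift ν) := lt_min (by linarith) hc.1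
  obtain ⟨j, rfl⟩ := Nat.exists_eq_succ_of_ne_zero hk.ne'
  have hj : (0 : ℝ) ≤ j := Nat.cast_nonneg j
  -- The midpoints `jπ + π/2` and `(j + 1)π + π/2` lie outside the bands, whose half-width is below
  -- `π/4`, and the signs there are opposite.
  have s1 := neg_one_pow_mul_besselSeries_pos (x := j * Real.pi + Real.pi / 2) h0 h1 j
    (by linarith) (by linarith)
  have s2 := neg_one_pow_mul_besselSeries_pos (x := (j + 1) * Real.pi + Real.pi / 2) h0 h1 (j + 1)
    (by push_cast; linarith) (by push_cast; linarith)
  rw [pow_succ, mul_neg_one, neg_mul] at s2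
  have hcont : ContinuousOn (fun x => (-1) ^ j * besselSeries ν x)
      (Set.Icc (j * Real.pi + Real.pi / 2) ((j + 1) * Real.pi + Real.pi / 2)) :=
    ((continuous_besselSeries (by linarith : -1 < ν)).const_mul _).continuousOn
  obtain ⟨x, hx, hx0⟩ := intermediate_value_Icc' (by nlinarith) hcont
    (show (0 : ℝ) ∈ _ from ⟨by linarith, s1.le⟩)
  have hz : besselSeries ν x = 0 := by
    rcases mul_eq_zero.1 hx0 with h | h
    · exact absurd h (pow_ne_zero _ (by norm_num))
    · exact h
  have hxpos : 0 < x := by nlinarith [hx.1]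
  refine ⟨x, ?_, hz⟩
  obtain ⟨m, hm, hxm⟩ := exists_mem_Icc_of_besselSeries_eq_zero h0 h1 hxpos hz
  have e1 : (m : ℝ) < (j + 2 : ℕ) := by
    have : (m : ℝ) * Real.pi < (j + 2) * Real.pi := by linarith [hxm.1, hx.2]
    push_cast
    exact lt_of_mul_lt_mul_right this hpi.le
  have e2 : (j : ℝ) < m := by
    have : (j : ℝ) * Real.pi < m * Real.pi := by linarith [hxm.2, hx.1]
    exact lt_of_mul_lt_mul_right this hpi.le
  have e3 : m = j + 1 := by
    have := Nat.cast_lt.1 e1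
    have := Nat.cast_lt.1 e2
    omega
  rw [e3] at hxm
  exact hxm

/-- Raising the index by one adds `π/2` to the shift, so on the band at `kπ` every `x - (ν + 1/2)θ`
falls in `((k - 1)π, kπ)` and the sign is constant. The condition `ν ≤ 1/2` keeps `ν + 1` within the
range of the sign criterion. -/
theorem besselSeries_add_one_ne_zero {ν x : ℝ} (h0 : 0 < ν) (h1 : ν ≤ 1 / 2) {k : ℕ} (hk : 0 < k)
    (hx1 : k * Real.pi + besselShift ν ≤ x) (hx2 : x ≤ k * Real.pi) :
    besselSeries (ν + 1) x ≠ 0 := by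
  have hpi := Real.pi_pos
  obtain ⟨j, rfl⟩ := Nat.exists_eq_succ_of_ne_zero hk.ne'
  have hj : (0 : ℝ) ≤ j := Nat.cast_nonneg j
  have hx : 0 < x := by
    have := (abs_lt.1 (abs_besselShift_lt h0 (by linarith))).1
    push_cast at hx1
    nlinarith
  have := mul_besselSeries_pos (ν := ν + 1) (x := x) (s := (-1) ^ j) (by linarith) (by linarith) hx
    fun θ hθ => by
      have h2 : 0 < (ν + 1 - 1 / 2) * θ := mul_pos (by linarith) hθ.1
      have h3 : (ν + 1 - 1 / 2) * θ < besselShift ν + Real.pi / 2 := by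
        have := mul_lt_mul_of_pos_left hθ.2 (show 0 < ν + 1 - 1 / 2 by linarith)
        rw [besselShift]
        linarith
      push_cast at hx1 hx2
      exact neg_one_pow_mul_sin_pos (by linarith) (by linarith)
  exact right_ne_zero_of_mul this.ne'

theorem besselSeries_sub_one_ne_zero {ν x : ℝ} (h0 : 1 / 2 < ν) (h1 : ν < 1) {k : ℕ} (hk : 0 < k)
    (hx1 : k * Real.pi ≤ x) (hx2 : x ≤ k * Real.pi + besselShift ν) :
    besselSeries (ν - 1) x ≠ 0 := by
  have hpi := Real.pi_pos
  have hk' : (0 : ℝ) < k := Nat.cast_pos.2 hk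
  have hx : 0 < x := lt_of_lt_of_le (by positivity) hx1
  have := mul_besselSeries_pos (ν := ν - 1) (x := x) (s := (-1) ^ k) (by linarith) (by linarith) hx
    fun θ hθ => by
      have h2 : 0 < (3 / 2 - ν) * θ := mul_pos (by linarith) hθ.1
      have h3 : (3 / 2 - ν) * θ < Real.pi / 2 - besselShift ν := by
        have := mul_lt_mul_of_pos_left hθ.2 (show 0 < 3 / 2 - ν by linarith)
        rw [besselShift]
        linarith
      exact neg_one_pow_mul_sin_pos (by linarith) (by linarith)
  exact right_ne_zero_of_mul this.ne'

/-- Rolle's theorem would give a zero of the series of index `ν + 1` (if `ν ≤ 1/2`) or `ν - 1` (if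
`ν > 1/2`) inside the band, where neither vanishes. The case split keeps the new index in `(-1/2,
3/2]`. -/
theorem not_two_zeros_besselSeries {ν x y : ℝ} (h0 : 0 < ν) (h1 : ν < 1) {k : ℕ} (hk : 0 < k)
    (hx : k * Real.pi + min 0 (besselShift ν) ≤ x) (hy : y ≤ k * Real.pi + max 0 (besselShift ν))
    (hxy : x < y) (hzx : besselSeries ν x = 0) (hzy : besselSeries ν y = 0) : False := by
  have hpi := Real.pi_pos
  have hk' : (1 : ℝ) ≤ k := by exact_mod_cast hk
  have hx0 : 0 < x := by
    have h := (abs_lt.1 (abs_besselShift_lt h0 h1)).1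
    have : -(Real.pi / 4) < min 0 (besselShift ν) := lt_min (by linarith) h
    nlinarith
  have hcont := continuous_besselSeries (by linarith : -1 < ν)
  rcases le_or_gt ν (1 / 2) with h | h
  · have hc : besselShift ν ≤ 0 :=
      mul_nonpos_of_nonpos_of_nonneg (by linarith) (by positivity)
    rw [min_eq_right hc] at hx
    rw [max_eq_left hc] at hy
    obtain ⟨z, hz, hz0⟩ := exists_hasDerivAt_eq_zero hxy hcont.continuousOn (hzx.trans hzy.symm)
      fun z _ => hasDerivAt_besselSeries_eq (by linarith : -1 < ν) z
    have := besselSeries_add_one_ne_zero (x := z) h0 h hk (by linarith [hz.1]) (by linarith [hz.2])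
    refine mul_ne_zero (neg_ne_zero.2 ?_) this hz0
    linarith [hz.1]
  · have hc : 0 ≤ besselShift ν := mul_nonneg (by linarith) (by positivity)
    rw [min_eq_left hc] at hx
    rw [max_eq_right hc] at hy
    have hd : ∀ z ∈ Set.Ioo x y, HasDerivAt (fun z => z ^ (2 * ν) * besselSeries ν z)
        (2 * z ^ (2 * ν - 1) * besselSeries (ν - 1) z) z := by
      intro z hz
      have hz0 : 0 < z := hx0.trans hz.1
      refine ((Real.hasDerivAt_rpow_const (Or.inl hz0.ne')).mul
        (hasDerivAt_besselSeries_eq (by linarith : -1 < ν) z)).congr_deriv ?_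
      rw [besselSeries_sub_one h0]
      have : z ^ (2 * ν) = z ^ (2 * ν - 1) * z := by
        rw [← Real.rpow_add_one hz0.ne', sub_add_cancel]
      rw [this]
      ring
    have hcont' : ContinuousOn (fun z => z ^ (2 * ν) * besselSeries ν z) (Set.Icc x y) :=
      ((Real.continuous_rpow_const (by linarith)).mul hcont).continuousOn
    obtain ⟨z, hz, hz0⟩ := exists_hasDerivAt_eq_zero hxy hcont' (by simp only [hzx, hzy, mul_zero]) hd
    have := besselSeries_sub_one_ne_zero (x := z) h h1 hk (by linarith [hz.1]) (by linarith [hz.2])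
    have hzpos : 0 < z := hx0.trans hz.1
    exact mul_ne_zero (by positivity) this hz0

theorem exists_isOrderedBesselZeros {ν : ℝ} (h0 : 0 < ν) (h1 : ν < 1) :
    ∃ ω : ℤ → ℝ, IsOrderedBesselZeros ν ω ∧ ∀ k, |ω k - k * Real.pi| ≤ |besselShift ν| := by
  have hpi := Real.pi_pos
  have hc := abs_besselShift_lt h0 h1
  choose z hz hz0 using fun k : ℕ => exists_besselSeries_eq_zero h0 h1 k.succ_pos
  -- Since `z n` is the zero near `(n + 1)π`, prepending `0` makes `ζ n` the one near `nπ`; evenness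
  -- of the series then gives the odd extension `ω`.
  let ζ : ℕ → ℝ := fun n => Nat.casesOn n 0 z
  have hζ : ∀ n, |ζ n - n * Real.pi| ≤ |besselShift ν| := by
    rintro (_ | n)
    · simp [ζ]
    · have h := hz n
      have e1 : max 0 (besselShift ν) ≤ |besselShift ν| := max_le (abs_nonneg _) (le_abs_self _)
      have e2 : -|besselShift ν| ≤ min 0 (besselShift ν) :=
        le_min (neg_nonpos.2 (abs_nonneg _)) (neg_abs_le _)
      rw [abs_le]
      constructor
      · have := h.1
        change _ ≤ z n - _
        linarith
      · have := h.2
        change z n - _ ≤ _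
        linarith
  let ω : ℤ → ℝ := fun k => k.sign * ζ k.natAbs
  have hω : ∀ k, |ω k - k * Real.pi| ≤ |besselShift ν| := by
    intro k
    have e : ω k - k * Real.pi = (k.sign : ℝ) * (ζ k.natAbs - k.natAbs * Real.pi) := by
      have : (k : ℝ) = (k.sign : ℝ) * (k.natAbs : ℝ) := by
        conv_lhs => rw [← Int.sign_mul_natAbs k]
        rw [Int.cast_mul, Int.cast_natCast]
      conv_lhs => rw [this]
      ring
    rw [e, abs_mul]
    refine (mul_le_of_le_one_left (abs_nonneg _) ?_).trans (hζ _)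
    rcases lt_trichotomy k 0 with h | h | h
    · simp [Int.sign_eq_neg_one_of_neg h]
    · simp [h]
    · simp [Int.sign_eq_one_of_pos h]
  have hmono : StrictMono ω := by
    -- Consecutive centres are `π` apart while each displacement is below `π/4`.
    refine strictMono_int_of_lt_succ fun k => ?_
    have e1 := abs_le.1 (hω k)
    have e2 := abs_le.1 (hω (k + 1))
    push_cast at e2
    linarith [e1.2, e2.1]
  have hω0 : ω 0 = 0 := by simp [ω]
  have hpos : ∀ x > 0, besselSeries ν x = 0 → ∃ n : ℕ, x = ζ n := by
    intro x hx hzx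
    obtain ⟨k, hk, hxk⟩ := exists_mem_Icc_of_besselSeries_eq_zero h0 h1 hx hzx
    obtain ⟨j, rfl⟩ := Nat.exists_eq_succ_of_ne_zero hk.ne'
    refine ⟨j + 1, ?_⟩
    rcases lt_trichotomy x (z j) with h | h | h
    · exact (not_two_zeros_besselSeries h0 h1 hk hxk.1 (hz j).2 h hzx (hz0 j)).elim
    · exact h
    · exact (not_two_zeros_besselSeries h0 h1 hk (hz j).1 hxk.2 h (hz0 j) hzx).elim
  refine ⟨ω, ⟨hmono, hω0, ?_⟩, hω⟩
  ext x
  rw [Set.mem_ofPred_eq, besselJ_ofReal_eq_zero_iff h0]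
  constructor
  · rintro ⟨k, rfl⟩
    rcases eq_or_ne k 0 with rfl | hk
    · exact Or.inl hω0
    · right
      obtain ⟨j, hj⟩ := Nat.exists_eq_succ_of_ne_zero (Int.natAbs_ne_zero.2 hk)
      have e : besselSeries ν (ζ k.natAbs) = 0 := by rw [hj]; exact hz0 j
      rcases lt_or_gt_of_ne hk with h | h
      · simp [ω, Int.sign_eq_neg_one_of_neg h, besselSeries_neg, e]
      · simp [ω, Int.sign_eq_one_of_pos h, e]
  · rintro (rfl | hx)
    · exact ⟨0, hω0⟩
    · rcases lt_trichotomy x 0 with h | h | h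
      · obtain ⟨n, hn⟩ := hpos (-x) (neg_pos.2 h) (by rw [besselSeries_neg, hx])
        refine ⟨-n, ?_⟩
        rcases Nat.eq_zero_or_pos n with rfl | hn0
        · simp [ζ] at hn
          exact absurd hn h.ne
        · simp only [ω]
          rw [Int.sign_eq_neg_one_of_neg (by omega), Int.natAbs_neg, Int.natAbs_natCast, ← hn]
          simp
      · exact ⟨0, by rw [hω0, h]⟩
      · obtain ⟨n, hn⟩ := hpos x h hx
        refine ⟨n, ?_⟩
        rcases Nat.eq_zero_or_pos n with rfl | hn0
        · simp [ζ] at hn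
          exact absurd hn h.ne'
        · simp only [ω]
          rw [Int.sign_eq_one_of_pos (by omega), Int.natAbs_natCast, ← hn]
          simp

theorem lemma3 (H : ℝ) (hH : H ∈ Set.Ioo (0 : ℝ) 1) :
    (∃ ω : ℤ → ℝ, IsOrderedBesselZeros (1 - H) ω) ∧
      ∀ ω : ℤ → ℝ, IsOrderedBesselZeros (1 - H) ω →
        IsRieszBasis (𝕜 := ℂ) (fun k : ℤ => expL2 (2 * ω k)) := by
  have h0 : 0 < 1 - H := by linarith [hH.2]
  have h1 : 1 - H < 1 := by linarith [hH.1]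
  have hpi := Real.pi_pos
  obtain ⟨ω₀, hω₀, hb⟩ := exists_isOrderedBesselZeros h0 h1
  refine ⟨⟨ω₀, hω₀⟩, fun ω hω => ?_⟩
  obtain rfl : ω = ω₀ := hω.1.eq_of_range_eq_of_zero_eq hω₀.1 (hω.2.2.trans hω₀.2.2.symm)
    (hω.2.1.trans hω₀.2.1.symm)
  have h := isRieszBasis_expL2_of_abs_sub_le (lam := fun k => ω k / Real.pi)
    (L := |besselShift (1 - H)| / Real.pi)
    (by rw [div_lt_iff₀ hpi]; linarith [abs_besselShift_lt h0 h1]) fun k => by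
      rw [div_sub' hpi.ne', mul_comm Real.pi, abs_div, abs_of_pos hpi]
      exact div_le_div_of_nonneg_right (hb k) hpi.le
  convert h using 3 with k
  field_simp
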